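/- A function $h:\mathbb R\to\mathbb C$ is called positive definite if for every finite family $x_1,\dots,x_n\in\mathbb R$ the matrix $[h(x_i-x_j)]_{i,j}$ is positive semidefinite (no continuity is assumed). Theorem. Let $f:\mathbb R\to\mathbb C$ satisfy: (i) $f\in L^2(\mathbb R)+\mathbb C\,1$; (ii) $|f|$ is bounded and bounded away from zero; (iii) $f^\lambda$ is positive definite for all real $\lambda>0$, where $f^\lambda:=e^{\lambda g}$ for some fixed, arbitrary choice of a function $g:\mathbb R\to\mathbb C$ with $e^{g}=f$ (for instance the principal logarithm of $f$, or a continuous logarithm when $f$ is continuous). Then there are positive definite functions $\Phi_+,\Phi_-:\mathbb R\to\mathbb C$ with $f(x)=\Phi_+(x)\Phi_-(x)$ for every $x\in\mathbb R$, such that $\Phi_+$ extends to a bounded holomorphic function on the upper half plane and $\Phi_-$ extends to a bounded holomorphic function on the lower half plane. Here "extends" means: there is a function $F_\pm$, bounded and holomorphic in the open half plane $\{\pm\operatorname{Im}z>0\}$ and continuous on its closure, with $F_\pm(x)=\Phi_\pm(x)$ for almost every $x\in\mathbb R$; if $f$ is continuous, then $F_\pm(x)=\Phi_\pm(x)$ for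 every $x\in\mathbb R$. -/

import Mathlib

open MeasureTheory
open scoped ComplexOrder

/-- A function `f : ℝ → ℂ` is positive definite if all matrices `[f (x i - x j)]`, for finite
families of real points, are positive semidefinite. No continuity is included. -/
def IsPositiveDefiniteFun (f : ℝ → ℂ) : Prop :=
  ∀ (n : ℕ) (x : Fin n → ℝ), (Matrix.of fun i j => f (x i - x j)).PosSemidef

/-- The open upper half plane. -/
def upperHalf : Set ℂ := {z | 0 < z.im}

/-- The open lower half plane. -/
def lowerHalf : Set ℂ := {z | z.im < 0}

/-- `F` is a bounded holomorphic function on the open set `U` (one of the two half planes),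
continuous up to the boundary, whose boundary values agree with `Φ` almost everywhere on `ℝ`. -/
structure IsBoundedHolomorphicExtension (U : Set ℂ) (F : ℂ → ℂ) (Φ : ℝ → ℂ) : Prop where
  holomorphic : DifferentiableOn ℂ F U
  continuous_closure : ContinuousOn F (closure U)
  bounded : ∃ C : ℝ, ∀ z ∈ U, ‖F z‖ ≤ C
  boundary : ∀ᵐ x : ℝ, F (x : ℂ) = Φ x

/-! Differentiating `exp (s * g)` at `s = 0` shows that `g` is conditionally positive definite, and
the two-sided bound on `|f|` bounds `Re g`. Three-point forms then make `Im g` additive up to a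
bounded error, so by Hyers' theorem it is an additive `α` plus a bounded function. Removing `iα`,
which forms of total mass zero do not see, leaves a bounded function; averaging over almost
invariant finite sets makes it positive definite after adding a constant. Hence `f = e^{-K} e^{iα}
e^φ` with `φ` positive definite.

Neither `g` nor `α` is assumed measurable, but `Re φ = log |f| + K` is a.e. measurable because `f`
is. A positive definite function with measurable real part is measurable (`aemeasurable_of_re`), so
`e^{iα}` is a measurable character, that is `e^{itx}`. Bochner's theorem without continuity gives `φ
= charFun μ` a.e., and the remainder `ψ = φ - charFun μ` is positive definite and a.e. zero
(`sub_of_ae_eq`).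

The factorization is now additive: cut `μ` at `0` and `t` into its positive and negative parts. The
transform of a finite measure on a half line extends boundedly to a half plane, hence so does its
exponential, and exponentials preserve positive definiteness. The factor `e^ψ` is a.e. `1` and joins
one side; for continuous `f` it is identically `1`. -/

open Filter Topology ComplexConjugate

/-! ### Quadratic forms and closure properties of positive definite functions. -/

/-- The real part of the quadratic form attached to the kernel `f (x - y)`. -/
noncomputable def quadForm {ι : Type*} [Fintype ι] (f : ℝ → ℂ) (x : ι → ℝ) (c : ι → ℂ) : ℝ :=
  (∑ i, ∑ j, conj (c i) * c j * f (x i - x j)).re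

section quadForm

variable {ι : Type*} [Fintype ι] (f h : ℝ → ℂ) (x : ι → ℝ) (c : ι → ℂ)

lemma quadForm_add : quadForm (fun t => f t + h t) x c = quadForm f x c + quadForm h x c := by
  simp [quadForm, mul_add, Finset.sum_add_distrib]

lemma quadForm_sub : quadForm (fun t => f t - h t) x c = quadForm f x c - quadForm h x c := by
  simp [quadForm, mul_sub, Finset.sum_sub_distrib]

lemma quadForm_ofReal_mul (r : ℝ) : quadForm (fun t => r * f t) x c = r * quadForm f x c := by
  rw [quadForm, quadForm, ← Complex.re_ofReal_mul, Finset.mul_sum]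
  simp only [Finset.mul_sum]
  congr 1
  refine Finset.sum_congr rfl fun i _ => Finset.sum_congr rfl fun j _ => by ring

lemma quadForm_const (z : ℂ) : quadForm (fun _ => z) x c = ‖∑ i, c i‖ ^ 2 * z.re := by
  have : ∑ i, ∑ j, conj (c i) * c j * z = ((‖∑ i, c i‖ ^ 2 : ℝ) : ℂ) * z := by
    push_cast
    rw [← Complex.conj_mul', map_sum, Finset.sum_mul_sum, Finset.sum_mul]
    simp [Finset.sum_mul]
  rw [quadForm, this, Complex.re_ofReal_mul]

lemma quadForm_reindex {κ : Type*} [Fintype κ] (e : κ ≃ ι) :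
    quadForm f (x ∘ e) (c ∘ e) = quadForm f x c := by
  simp only [quadForm, Function.comp]
  rw [← e.sum_comp]
  congr 1
  refine Finset.sum_congr rfl fun i _ => ?_
  rw [← e.sum_comp]

lemma tendsto_quadForm {α : Type*} {l : Filter α} {F : α → ℝ → ℂ} {f : ℝ → ℂ}
    (hF : ∀ t, Tendsto (fun a => F a t) l (𝓝 (f t))) :
    Tendsto (fun a => quadForm (F a) x c) l (𝓝 (quadForm f x c)) := by
  unfold quadForm
  refine (Complex.continuous_re.tendsto _).comp ?_
  exact tendsto_finsetSum _ fun i _ => tendsto_finsetSum _ fun j _ => (hF _).const_mul _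

end quadForm

lemma quadForm_eq_re_finsuppSum {n : ℕ} (f : ℝ → ℂ) (x : Fin n → ℝ) (c : Fin n →₀ ℂ) :
    (c.sum fun i ci => c.sum fun j cj => star ci * (Matrix.of fun i j => f (x i - x j)) i j * cj)
      = ∑ i, ∑ j, conj (c i) * c j * f (x i - x j) := by
  rw [Finsupp.sum_fintype _ _ (by simp [Finsupp.sum])]
  refine Finset.sum_congr rfl fun i _ => ?_
  rw [Finsupp.sum_fintype _ _ (by simp)]
  refine Finset.sum_congr rfl fun j _ => ?_
  simp only [Matrix.of_apply, Complex.star_def]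
  ring

namespace IsPositiveDefiniteFun

variable {f h : ℝ → ℂ}

lemma neg_eq_conj (hf : IsPositiveDefiniteFun f) (x : ℝ) : f (-x) = conj (f x) := by
  have := (hf 2 ![0, x]).1.apply 0 1
  simpa using this.symm

lemma quadForm_fin_nonneg (hf : IsPositiveDefiniteFun f) {n : ℕ} (x : Fin n → ℝ)
    (c : Fin n → ℂ) : 0 ≤ quadForm f x c := by
  have := (hf n x).2 (Finsupp.equivFunOnFinite.symm c)
  rw [quadForm_eq_re_finsuppSum] at this
  exact (Complex.le_def.1 this).1

lemma quadForm_nonneg (hf : IsPositiveDefiniteFun f) {ι : Type*} [Fintype ι] (x : ι → ℝ)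
    (c : ι → ℂ) : 0 ≤ quadForm f x c := by
  rw [← quadForm_reindex f x c (Fintype.equivFin ι).symm]
  exact hf.quadForm_fin_nonneg _ _

/-- `quadForm` keeps only the real part; hermitian symmetry makes the full sum real. -/
lemma of_quadForm (hneg : ∀ x, f (-x) = conj (f x))
    (hf : ∀ (n : ℕ) (x : Fin n → ℝ) (c : Fin n → ℂ), 0 ≤ quadForm f x c) :
    IsPositiveDefiniteFun f := by
  intro n x
  refine ⟨?_, fun c => ?_⟩
  · ext i j
    simp [Matrix.conjTranspose_apply, ← hneg]
  · rw [quadForm_eq_re_finsuppSum, Complex.le_def]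
    refine ⟨hf n x c, ?_⟩
    have : conj (∑ i, ∑ j, conj (c i) * c j * f (x i - x j))
        = ∑ i, ∑ j, conj (c i) * c j * f (x i - x j) := by
      conv_lhs => rw [Finset.sum_comm]
      simp only [map_sum, map_mul, ← hneg, neg_sub, Complex.conj_conj]
      refine Finset.sum_congr rfl fun i _ => Finset.sum_congr rfl fun j _ => by ring
    exact (Complex.conj_eq_iff_im.1 this).symm

lemma add (hf : IsPositiveDefiniteFun f) (hh : IsPositiveDefiniteFun h) :
    IsPositiveDefiniteFun fun x => f x + h x :=
  of_quadForm (fun x => by simp [hf.neg_eq_conj, hh.neg_eq_conj]) fun n x c => by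
    rw [quadForm_add]; exact add_nonneg (hf.quadForm_nonneg x c) (hh.quadForm_nonneg x c)

lemma mul (hf : IsPositiveDefiniteFun f) (hh : IsPositiveDefiniteFun h) :
    IsPositiveDefiniteFun fun x => f x * h x := fun n x => (hf n x).hadamard (hh n x)

lemma const {r : ℝ} (hr : 0 ≤ r) : IsPositiveDefiniteFun fun _ => (r : ℂ) :=
  of_quadForm (fun x => by simp) fun n x c => by
    rw [quadForm_const]; exact mul_nonneg (by positivity) (by simpa using hr)

lemma ofReal_mul (hf : IsPositiveDefiniteFun f) {r : ℝ} (hr : 0 ≤ r) :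
    IsPositiveDefiniteFun fun x => r * f x := (const hr).mul hf

lemma conj_fun (hf : IsPositiveDefiniteFun f) : IsPositiveDefiniteFun fun x => conj (f x) :=
  of_quadForm (fun x => by simp [hf.neg_eq_conj]) fun n x c => by
    have := hf.quadForm_nonneg x (fun i => conj (c i))
    rw [quadForm, ← Complex.conj_re] at this
    simpa [quadForm] using this

lemma of_tendsto {α : Type*} {l : Filter α} [l.NeBot] {F : α → ℝ → ℂ}
    (hF : ∀ a, IsPositiveDefiniteFun (F a)) (h : ∀ t, Tendsto (fun a => F a t) l (𝓝 (f t))) :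
    IsPositiveDefiniteFun f := by
  refine of_quadForm (fun x => ?_) fun n x c => ?_
  · refine tendsto_nhds_unique (h (-x)) ?_
    simp only [(hF _).neg_eq_conj]
    exact (Complex.continuous_conj.tendsto _).comp (h x)
  · exact ge_of_tendsto' (tendsto_quadForm x c h) fun a => (hF a).quadForm_nonneg x c

lemma pow (hf : IsPositiveDefiniteFun f) (n : ℕ) : IsPositiveDefiniteFun fun x => f x ^ n := by
  induction n with
  | zero => simpa using const (r := 1) zero_le_one
  | succ n ih => simpa only [pow_succ] using ih.mul hf

lemma zero : IsPositiveDefiniteFun fun _ => (0 : ℂ) := by simpa using const (r := 0) le_rfl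

lemma sum {ι : Type*} (s : Finset ι) {F : ι → ℝ → ℂ} (hF : ∀ i, IsPositiveDefiniteFun (F i)) :
    IsPositiveDefiniteFun fun x => ∑ i ∈ s, F i x := by
  classical
  induction s using Finset.induction_on with
  | empty => simpa using zero
  | insert i s hi ih => simpa only [Finset.sum_insert hi] using (hF i).add ih

lemma exp (hf : IsPositiveDefiniteFun f) : IsPositiveDefiniteFun fun x => Complex.exp (f x) := by
  refine of_tendsto (l := atTop)
    (F := fun n x => ∑ k ∈ Finset.range n, ((1 / (k.factorial : ℝ) : ℝ) : ℂ) * f x ^ k)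
    (fun n => sum _ fun k => (hf.pow k).ofReal_mul (by positivity)) fun t => ?_
  have := (NormedSpace.expSeries_div_hasSum_exp (f t)).tendsto_sum_nat
  rw [← Complex.exp_eq_exp_ℂ] at this
  refine this.congr fun n => Finset.sum_congr rfl fun k _ => ?_
  push_cast; ring

lemma map_zero_nonneg (hf : IsPositiveDefiniteFun f) : 0 ≤ (f 0).re := by
  have := hf.quadForm_nonneg (fun _ : Unit => 0) (fun _ => 1)
  simpa [quadForm] using this

end IsPositiveDefiniteFun

/-! ### Conditionally positive definite functions as logarithms. -/

/-- A hermitian function whose quadratic form is nonnegative on weights of total mass zero. -/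
structure IsConditionallyPositiveDefiniteFun (g : ℝ → ℂ) : Prop where
  neg_eq_conj : ∀ x, g (-x) = conj (g x)
  quadForm_nonneg : ∀ (n : ℕ) (x : Fin n → ℝ) (c : Fin n → ℂ), ∑ i, c i = 0 → 0 ≤ quadForm g x c

lemma IsConditionallyPositiveDefiniteFun.quadForm_nonneg' {g : ℝ → ℂ}
    (hg : IsConditionallyPositiveDefiniteFun g) {ι : Type*} [Fintype ι] (x : ι → ℝ) (c : ι → ℂ)
    (hc : ∑ i, c i = 0) : 0 ≤ quadForm g x c := by
  rw [← quadForm_reindex g x c (Fintype.equivFin ι).symm]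
  refine hg.quadForm_nonneg _ _ _ ?_
  rw [← hc, ← (Fintype.equivFin ι).symm.sum_comp]
  rfl

lemma tendsto_mul_exp_div_sub_one (z : ℂ) :
    Tendsto (fun s : ℝ => (s : ℂ)⁻¹ * (Complex.exp (s * z) - 1)) (𝓝[>] 0) (𝓝 z) := by
  have h : HasDerivAt (fun s : ℝ => Complex.exp (s * z)) z 0 := by
    have := ((Complex.ofRealCLM.hasDerivAt (x := 0)).mul_const z).cexp
    simpa using this
  have := h.tendsto_slope_zero_right
  simpa using this

/-- `g` is the limit of `(e^{sg} - 1) / s` as `s` decreases to `0`, and the constant `1` contributes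
nothing on weights of mass zero. -/
lemma IsConditionallyPositiveDefiniteFun.of_exp {g : ℝ → ℂ}
    (hpow : ∀ s : ℝ, 0 < s → IsPositiveDefiniteFun (fun x => Complex.exp ((s : ℂ) * g x))) :
    IsConditionallyPositiveDefiniteFun g where
  neg_eq_conj x := by
    refine tendsto_nhds_unique (tendsto_mul_exp_div_sub_one (g (-x))) ?_
    refine ((Complex.continuous_conj.tendsto _).comp (tendsto_mul_exp_div_sub_one (g x))).congr' ?_
    filter_upwards [self_mem_nhdsWithin] with s hs
    rw [(hpow s hs).neg_eq_conj x]
    simp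
  quadForm_nonneg n x c hc := by
    refine ge_of_tendsto (tendsto_quadForm x c fun t => tendsto_mul_exp_div_sub_one (g t)) ?_
    filter_upwards [self_mem_nhdsWithin] with s hs
    have hs' : 0 < s := hs
    have h1 := quadForm_ofReal_mul (fun t => Complex.exp (s * g t) - 1) x c s⁻¹
    push_cast at h1
    rw [h1, quadForm_sub, quadForm_const, hc]
    simpa using mul_nonneg (inv_pos.2 hs').le ((hpow s hs).quadForm_nonneg x c)

/-! ### Stability of additivity and almost invariant averages. -/

/-- Hyers' theorem: a function which is additive up to a bounded error is at bounded distance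
from an additive one. -/
lemma exists_addMonoidHom_abs_sub_le {q : ℝ → ℝ} {D : ℝ}
    (hq : ∀ u v, |q (u + v) - q u - q v| ≤ D) : ∃ α : ℝ →+ ℝ, ∀ x, |q x - α x| ≤ D := by
  -- The additive function is the limit of `q (2 ^ n x) / 2 ^ n`; doubling costs at most `D / 2 ^ (n
  -- + 1)`, and these errors sum to `D`.
  have hstep : ∀ x : ℝ, ∀ n : ℕ,
      dist (q (2 ^ n * x) / 2 ^ n) (q (2 ^ (n + 1) * x) / 2 ^ (n + 1)) ≤ D / 2 / 2 ^ n := by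
    intro x n
    have h := hq (2 ^ n * x) (2 ^ n * x)
    have e : (2 : ℝ) ^ (n + 1) * x = 2 ^ n * x + 2 ^ n * x := by ring
    rw [dist_comm, Real.dist_eq, e,
      show q (2 ^ n * x + 2 ^ n * x) / 2 ^ (n + 1) - q (2 ^ n * x) / 2 ^ n
      = (q (2 ^ n * x + 2 ^ n * x) - q (2 ^ n * x) - q (2 ^ n * x)) / 2 / 2 ^ n by field_simp; ring,
      abs_div, abs_div, abs_of_pos (by positivity : (0 : ℝ) < 2),
      abs_of_pos (by positivity : (0 : ℝ) < 2 ^ n)]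
    gcongr
  choose a ha using fun x => cauchySeq_tendsto_of_complete (cauchySeq_of_le_geometric_two (hstep x))
  have hadd : ∀ x y, a (x + y) = a x + a y := by
    intro x y
    have h1 : Tendsto (fun n : ℕ => q (2 ^ n * (x + y)) / 2 ^ n - q (2 ^ n * x) / 2 ^ n
        - q (2 ^ n * y) / 2 ^ n) atTop (𝓝 (a (x + y) - a x - a y)) :=
      ((ha _).sub (ha _)).sub (ha _)
    have h2 : Tendsto (fun n : ℕ => q (2 ^ n * (x + y)) / 2 ^ n - q (2 ^ n * x) / 2 ^ n
        - q (2 ^ n * y) / 2 ^ n) atTop (𝓝 0) := by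
      refine squeeze_zero_norm (a := fun n : ℕ => D * (1 / 2) ^ n) (fun n => ?_) ?_
      · rw [← sub_div, ← sub_div, Real.norm_eq_abs, abs_div, mul_add,
          abs_of_pos (by positivity : (0 : ℝ) < 2 ^ n), one_div, inv_pow, ← div_eq_mul_inv]
        gcongr
        exact hq _ _
      · simpa using (tendsto_pow_atTop_nhds_zero_of_lt_one (r := (1 / 2 : ℝ)) (by norm_num)
          (by norm_num)).const_mul D
    linarith [tendsto_nhds_unique h1 h2]
  refine ⟨AddMonoidHom.mk' a hadd, fun x => ?_⟩
  have := dist_le_of_le_geometric_two_of_tendsto₀ (hstep x) (ha x)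
  simpa [Real.dist_eq] using this

/-- Finite averages on `ℝ` that are almost invariant under finitely many translations, uniformly
on bounded functions. -/
lemma exists_almost_invariant_average (S : Finset ℝ) {ε : ℝ} (hε : 0 < ε) :
    ∃ (κ : Type) (_ : Fintype κ) (_ : Nonempty κ) (y : κ → ℝ), ∀ (G : ℝ → ℂ) (B : ℝ),
      (∀ t, ‖G t‖ ≤ B) → ∀ s ∈ S,
        ‖∑ k, (G (s + y k) - G (y k))‖ ≤ ε * B * Fintype.card κ := by
  classical
  induction S using Finset.induction_on with
  | empty => exact ⟨Unit, inferInstance, inferInstance, fun _ => 0, by simp⟩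
  | insert a S ha ih =>
    obtain ⟨κ, _, _, y, hy⟩ := ih
    -- Translates along a progression of step `a` and length `M`: shifting by `a` telescopes to two
    -- boundary values, so `2 ≤ ε M` is needed. Invariance under the older shifts survives, being
    -- uniform in `G`.
    obtain ⟨M, hM⟩ := exists_nat_gt (2 / ε)
    have hM0 : (0 : ℝ) < M := (by positivity : (0 : ℝ) < 2 / ε).trans hM
    have hM1 : 0 < M := by exact_mod_cast hM0
    have : Nonempty (Fin M) := ⟨⟨0, hM1⟩⟩
    refine ⟨κ × Fin M, inferInstance, inferInstance, fun p => y p.1 + (p.2 : ℕ) * a,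
      fun G B hG s hs => ?_⟩
    have hB : 0 ≤ B := (norm_nonneg _).trans (hG 0)
    rw [Fintype.card_prod, Fintype.card_fin]
    push_cast
    rcases Finset.mem_insert.1 hs with rfl | hs
    · rw [Fintype.sum_prod_type]
      have h1 : ∀ k : κ, ‖∑ m : Fin M, (G (s + (y k + (m : ℕ) * s)) - G (y k + (m : ℕ) * s))‖
          ≤ ε * B * M := by
        intro k
        rw [Fin.sum_univ_eq_sum_range (fun m => G (s + (y k + (m : ℕ) * s)) - G (y k + (m : ℕ) * s))]
        have := Finset.sum_range_sub (fun m : ℕ => G (y k + m * s)) M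
        rw [show ∑ m ∈ Finset.range M, (G (s + (y k + (m : ℕ) * s)) - G (y k + (m : ℕ) * s))
          = G (y k + M * s) - G (y k + (0 : ℕ) * s) by
            rw [← this]; refine Finset.sum_congr rfl fun m _ => ?_
            push_cast; congr 2; ring]
        have h2 : 2 ≤ ε * M := by
          rw [div_lt_iff₀ hε] at hM; linarith
        calc _ ≤ B + B := (norm_sub_le _ _).trans (add_le_add (hG _) (hG _))
          _ = 2 * B := by ring
          _ ≤ (ε * M) * B := by gcongr
          _ = ε * B * M := by ring
      refine (norm_sum_le _ _).trans ((Finset.sum_le_sum fun k _ => h1 k).trans (le_of_eq ?_))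
      simp; ring
    · rw [Fintype.sum_prod_type_right]
      have h1 : ∀ m : Fin M, ‖∑ k : κ, (G (s + (y k + (m : ℕ) * a)) - G (y k + (m : ℕ) * a))‖
          ≤ ε * B * Fintype.card κ := by
        intro m
        simpa only [add_assoc] using hy (fun t => G (t + (m : ℕ) * a)) B (fun t => hG _) s hs
      refine (norm_sum_le _ _).trans ((Finset.sum_le_sum fun k _ => h1 k).trans (le_of_eq ?_))
      simp; ring

/-! ### From conditionally positive definite to positive definite. -/

namespace IsConditionallyPositiveDefiniteFun

variable {g : ℝ → ℂ}

/-- Adjoining the point `y` with weight `-∑ c i` brings the total mass to zero. -/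
lemma balanced_quadForm_nonneg (hg : IsConditionallyPositiveDefiniteFun g) {ι : Type*} [Fintype ι]
    (x : ι → ℝ) (c : ι → ℂ) (y : ℝ) :
    0 ≤ quadForm g x c - 2 * ((∑ i, c i) * ∑ i, conj (c i) * g (x i - y)).re
      + ‖∑ i, c i‖ ^ 2 * (g 0).re := by
  obtain ⟨C, hC⟩ : ∃ C, ∑ i, c i = C := ⟨_, rfl⟩
  have h := hg.quadForm_nonneg' (ι := Option ι) (fun o => o.elim y x)
    (fun o => o.elim (-C) c) (by simp [Fintype.sum_option, hC])
  rw [hC]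
  have e1 : ∑ j, conj (-C) * c j * g (y - x j) = - conj (C * ∑ i, conj (c i) * g (x i - y)) := by
    rw [map_mul, map_sum, ← neg_mul, Finset.mul_sum, ← map_neg]
    refine Finset.sum_congr rfl fun i _ => ?_
    rw [map_mul, Complex.conj_conj, ← hg.neg_eq_conj, neg_sub, mul_assoc]
  have e2 : ∑ i, conj (c i) * (-C) * g (x i - y) = - (C * ∑ i, conj (c i) * g (x i - y)) := by
    rw [← neg_mul, Finset.mul_sum]
    exact Finset.sum_congr rfl fun i _ => by ring
  have e3 : conj (-C) * (-C) = ((‖C‖ ^ 2 : ℝ) : ℂ) := by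
    rw [map_neg, neg_mul_neg, Complex.conj_mul']; push_cast; rfl
  simp only [quadForm, Fintype.sum_option, Option.elim_none, Option.elim_some,
    Finset.sum_add_distrib, sub_self] at h
  rw [e1, e2, e3] at h
  simp only [Complex.add_re, Complex.neg_re, Complex.conj_re, Complex.re_ofReal_mul] at h
  rw [quadForm]
  linarith

/-- Weights `1, ±i` at `u, v`, balanced at `0`: the two signs give the two sides of the absolute
value. -/
lemma abs_im_sub_le (hg : IsConditionallyPositiveDefiniteFun g) (u v : ℝ) :
    |(g (u - v)).im - (g u).im + (g v).im| ≤ 2 * (g 0).re - (g u).re - (g v).re := by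
  have hvu : g (v - u) = conj (g (u - v)) := by rw [← hg.neg_eq_conj, neg_sub]
  have h1 := hg.balanced_quadForm_nonneg ![u, v] ![1, Complex.I] 0
  have h2 := hg.balanced_quadForm_nonneg ![u, v] ![1, -Complex.I] 0
  have n1 : ‖(1 : ℂ) + Complex.I‖ ^ 2 = 2 := by
    rw [Complex.sq_norm, Complex.normSq_apply]; norm_num
  have n2 : ‖(1 : ℂ) + -Complex.I‖ ^ 2 = 2 := by
    rw [Complex.sq_norm, Complex.normSq_apply]; norm_num
  simp [quadForm, Fin.sum_univ_two, hvu, n1, n2] at h1 h2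
  rw [abs_le]
  constructor <;> linarith

/-- A conditionally positive definite function with bounded real part is, up to an additive
character and a constant, a positive definite function. -/
theorem exists_isPositiveDefiniteFun (hg : IsConditionallyPositiveDefiniteFun g) {B : ℝ}
    (hB : ∀ x, |(g x).re| ≤ B) : ∃ (α : ℝ →+ ℝ) (K : ℝ),
      IsPositiveDefiniteFun fun x => g x - (α x : ℂ) * Complex.I + K := by
  have him : ∀ x, (g (-x)).im = -(g x).im := fun x => by rw [hg.neg_eq_conj]; simp
  obtain ⟨α, hα⟩ := exists_addMonoidHom_abs_sub_le (q := fun x => (g x).im) (D := 4 * B) (by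
    intro u v
    have h := hg.abs_im_sub_le u (-v)
    rw [sub_neg_eq_add, him] at h
    have h0 := abs_le.1 (hB 0); have h1 := abs_le.1 (hB u); have h2 := abs_le.1 (hB (-v))
    refine le_trans (le_of_eq ?_) (h.trans (by linarith))
    congr 1)
  set G : ℝ → ℂ := fun x => g x - (α x : ℂ) * Complex.I with hG
  have hGneg : ∀ x, G (-x) = conj (G x) := fun x => by
    simp [hG, hg.neg_eq_conj]
  have hGc : IsConditionallyPositiveDefiniteFun G := ⟨hGneg, fun n x c hc => by
    rw [hG, quadForm_sub]
    -- By additivity the kernel is a function of `x i` minus a function of `x j`, and each part is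
    -- annihilated by `∑ c = 0`.
    have : quadForm (fun x => (α x : ℂ) * Complex.I) x c = 0 := by
      have hc' : ∑ i, conj (c i) = 0 := by rw [← map_sum, hc, map_zero]
      rw [quadForm]
      have : ∀ i j, conj (c i) * c j * ((α (x i - x j) : ℂ) * Complex.I)
          = (conj (c i) * (α (x i) : ℂ) * Complex.I) * c j
            - conj (c i) * (c j * ((α (x j) : ℂ) * Complex.I)) := by
        intro i j; rw [map_sub]; push_cast; ring
      simp only [this, Finset.sum_sub_distrib, ← Finset.mul_sum, ← Finset.sum_mul, hc, hc']
      simp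
    rw [this, sub_zero]
    exact hg.quadForm_nonneg n x c hc⟩
  have hGB : ∀ x, ‖G x‖ ≤ 5 * B := fun x => by
    refine (Complex.norm_le_abs_re_add_abs_im _).trans ?_
    have h1 : (G x).re = (g x).re := by simp [hG]
    have h2 : (G x).im = (g x).im - α x := by simp [hG]
    rw [h1, h2]
    linarith [hB x, hα x]
  have hB0 : 0 ≤ B := (abs_nonneg _).trans (hB 0)
  -- With `‖G‖ ≤ 5B`, the averaged cross term costs `2 * 5B` and the diagonal value `G 0` costs
  -- `5B`.
  refine ⟨α, 15 * B, ?_⟩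
  change IsPositiveDefiniteFun fun x => G x + _
  refine IsPositiveDefiniteFun.of_quadForm
    (fun x => by simp only [map_add, hGneg, Complex.conj_ofReal]) fun n x c => ?_
  rw [quadForm_add G, quadForm_const]
  set C := ∑ i, c i with hC
  -- The balancing point runs over the `-y k`. On average `G (x i + y k)` may be replaced by `G (y
  -- k)`, which turns the cross term into `‖C‖ ^ 2` times a mean of `G`.
  have key : ∀ ε : ℝ, 0 < ε →
      0 ≤ quadForm G x c + ‖C‖ ^ 2 * (15 * B) + ε * (2 * ‖C‖ * (∑ i, ‖c i‖) * (5 * B)) := by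
    intro ε hε
    obtain ⟨κ, _, _, y, hy⟩ := exists_almost_invariant_average (Finset.univ.image x) hε
    have hN : (0 : ℝ) < Fintype.card κ := by exact_mod_cast Fintype.card_pos
    set N : ℝ := ((Fintype.card κ : ℕ) : ℝ) with hNdef
    have h1 : 0 ≤ ∑ k, (quadForm G x c - 2 * (C * ∑ i, conj (c i) * G (x i - -y k)).re
      + ‖C‖ ^ 2 * (G 0).re) :=
      Finset.sum_nonneg fun k _ => hGc.balanced_quadForm_nonneg x c (-y k)
    rw [Finset.sum_add_distrib, Finset.sum_sub_distrib, ← Finset.mul_sum, ← Complex.re_sum,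
      ← Finset.mul_sum] at h1
    simp only [Finset.sum_const, Finset.card_univ, nsmul_eq_mul, sub_neg_eq_add, ← hNdef] at h1
    have h2 : ∑ k, ∑ i, conj (c i) * G (x i + y k)
        = ∑ i, conj (c i) * ∑ k, (G (x i + y k) - G (y k)) + conj C * ∑ k, G (y k) := by
      rw [Finset.sum_comm, hC, map_sum, Finset.sum_mul, ← Finset.sum_add_distrib]
      refine Finset.sum_congr rfl fun i _ => ?_
      rw [← mul_add, ← Finset.sum_add_distrib, Finset.mul_sum]
      simp
    rw [h2, mul_add, ← mul_assoc C (conj C), Complex.mul_conj', Complex.add_re] at h1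
    have h3 : -(‖C‖ * (∑ i, ‖c i‖) * (ε * (5 * B) * N))
        ≤ (C * ∑ i, conj (c i) * ∑ k, (G (x i + y k) - G (y k))).re := by
      refine neg_le_of_abs_le ((Complex.abs_re_le_norm _).trans ?_)
      rw [norm_mul, mul_assoc]
      gcongr
      rw [Finset.sum_mul]
      refine (norm_sum_le _ _).trans (Finset.sum_le_sum fun i _ => ?_)
      rw [norm_mul, RCLike.norm_conj]
      gcongr
      exact hy G (5 * B) hGB _ (Finset.mem_image_of_mem _ (Finset.mem_univ i))
    have h4 : -(‖C‖ ^ 2 * (5 * B * N)) ≤ ((‖C‖ : ℂ) ^ 2 * ∑ k, G (y k)).re := by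
      rw [← Complex.ofReal_pow, Complex.re_ofReal_mul, ← mul_neg]
      gcongr
      refine neg_le_of_abs_le ((Complex.abs_re_le_norm _).trans ((norm_sum_le _ _).trans ?_))
      refine (Finset.sum_le_sum fun k _ => hGB (y k)).trans (le_of_eq ?_)
      simp [hNdef]; ring
    have h5 : ‖C‖ ^ 2 * (G 0).re ≤ ‖C‖ ^ 2 * (5 * B) := by
      gcongr
      exact ((le_abs_self _).trans (Complex.abs_re_le_norm _)).trans (hGB 0)
    have h6 : N * (‖C‖ ^ 2 * (G 0).re) ≤ N * (‖C‖ ^ 2 * (5 * B)) := by gcongr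
    refine nonneg_of_mul_nonneg_right (a := N) ?_ hN
    nlinarith [h1, h3, h4, h6]
  have : Tendsto (fun ε : ℝ => quadForm G x c + ‖C‖ ^ 2 * (15 * B)
      + ε * (2 * ‖C‖ * (∑ i, ‖c i‖) * (5 * B))) (𝓝[>] 0)
      (𝓝 (quadForm G x c + ‖C‖ ^ 2 * (15 * B) + 0 * (2 * ‖C‖ * (∑ i, ‖c i‖) * (5 * B)))) := by
    refine tendsto_nhdsWithin_of_tendsto_nhds (Continuous.tendsto ?_ 0)
    fun_prop
  have := ge_of_tendsto this (by filter_upwards [self_mem_nhdsWithin] with ε hε using key ε hε)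
  simpa using this

end IsConditionallyPositiveDefiniteFun

/-! ### Generic point sequences, the sup bound, and double integrals of kernels. -/

/-- Points can be picked one by one from sets of positive outer measure so that all differences
avoid a null set. -/
lemma exists_seq_pairs_sub_notMem {A B Z : Set ℝ} (hA : volume A ≠ 0) (hB : volume B ≠ 0)
    (hZ : volume Z = 0) : ∃ x y : ℕ → ℝ, (∀ n, x n ∈ A) ∧ (∀ n, y n ∈ B) ∧
      (∀ m n, m ≠ n → x m - x n ∉ Z) ∧ (∀ m n, m ≠ n → y m - y n ∉ Z) ∧
      ∀ m n, x m - y n ∉ Z := by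
  classical
  have hnull : ∀ p : ℝ, volume {t : ℝ | t - p ∈ Z ∨ p - t ∈ Z} = 0 := by
    intro p
    refine measure_union_null ?_ ?_
    · exact (measurePreserving_sub_right volume p).quasiMeasurePreserving.preimage_null hZ
    · exact (quasiMeasurePreserving_sub_left volume p).preimage_null hZ
  have hpick : ∀ (s : Finset ℝ) (A : Set ℝ), volume A ≠ 0 →
      ∃ a ∈ A, ∀ p ∈ s, a - p ∉ Z ∧ p - a ∉ Z := by
    intro s A hA
    by_contra! hcon
    refine hA (measure_mono_null (t := ⋃ p ∈ s, {t : ℝ | t - p ∈ Z ∨ p - t ∈ Z}) ?_ ?_)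
    · intro a ha
      obtain ⟨p, hp, h⟩ := hcon a ha
      simp only [Set.mem_iUnion]
      exact ⟨p, hp, by by_cases h1 : a - p ∈ Z <;> [exact Or.inl h1; exact Or.inr (h h1)]⟩
    · exact (measure_biUnion_null_iff s.countable_toSet).2 fun p _ => hnull p
  obtain ⟨f, hf, hf'⟩ := exists_seq_of_forall_finset_exists
    (α := ℝ × ℝ) (fun p => p.1 ∈ A ∧ p.2 ∈ B ∧ p.1 - p.2 ∉ Z)
    (fun p q => (q.1 - p.1 ∉ Z ∧ p.1 - q.1 ∉ Z) ∧ (q.2 - p.2 ∉ Z ∧ p.2 - q.2 ∉ Z) ∧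
      (q.1 - p.2 ∉ Z ∧ p.1 - q.2 ∉ Z)) (by
    intro s _
    obtain ⟨a, ha, ha'⟩ := hpick (s.image Prod.fst ∪ s.image Prod.snd) A hA
    obtain ⟨b, hb, hb'⟩ := hpick (insert a (s.image Prod.fst ∪ s.image Prod.snd)) B hB
    refine ⟨(a, b), ⟨ha, hb, (hb' a (Finset.mem_insert_self _ _)).2⟩, fun p hp => ?_⟩
    have h1 : p.1 ∈ s.image Prod.fst ∪ s.image Prod.snd :=
      Finset.mem_union_left _ (Finset.mem_image_of_mem _ hp)
    have h2 : p.2 ∈ s.image Prod.fst ∪ s.image Prod.snd :=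
      Finset.mem_union_right _ (Finset.mem_image_of_mem _ hp)
    exact ⟨ha' _ h1, hb' _ (Finset.mem_insert_of_mem h2), (ha' _ h2).1,
      (hb' _ (Finset.mem_insert_of_mem h1)).2⟩)
  refine ⟨fun n => (f n).1, fun n => (f n).2, fun n => (hf n).1, fun n => (hf n).2.1,
    fun m n hmn => ?_, fun m n hmn => ?_, fun m n => ?_⟩
  · rcases hmn.lt_or_gt with h | h
    · exact (hf' m n h).1.2
    · exact (hf' n m h).1.1
  · rcases hmn.lt_or_gt with h | h
    · exact (hf' m n h).2.1.2
    · exact (hf' n m h).2.1.1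
  · rcases lt_trichotomy m n with h | rfl | h
    · exact (hf' m n h).2.2.2
    · exact (hf m).2.2
    · exact (hf' n m h).2.2.1

/-- With the phase of `f x` put in the weights, the form at the points `x, 0` equals `2 f(0) - 2 ‖f
x‖`. -/
lemma IsPositiveDefiniteFun.norm_le {f : ℝ → ℂ} (hf : IsPositiveDefiniteFun f) (x : ℝ) :
    ‖f x‖ ≤ (f 0).re := by
  rcases eq_or_ne (f x) 0 with h0 | h0
  · rw [h0, norm_zero]; exact hf.map_zero_nonneg
  have hn : (‖f x‖ : ℂ) ≠ 0 := by simpa using h0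
  have h := hf.quadForm_nonneg ![x, 0] ![1, -(conj (f x)) / ‖f x‖]
  have h1 : conj (f x) * f x = (‖f x‖ : ℂ) * ‖f x‖ := by
    rw [Complex.conj_mul']; ring
  have h2 : f x * conj (f x) = (‖f x‖ : ℂ) * ‖f x‖ := by rw [mul_comm, h1]
  have e : (∑ i : Fin 2, ∑ j : Fin 2, conj (![1, -(conj (f x)) / (‖f x‖ : ℂ)] i)
      * ![1, -(conj (f x)) / (‖f x‖ : ℂ)] j * f ((![x, 0] : Fin 2 → ℝ) i - (![x, 0] : Fin 2 → ℝ) j))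
      = 2 * f 0 - 2 * ‖f x‖ := by
    simp only [Fin.sum_univ_two, Matrix.cons_val_zero, Matrix.cons_val_one, sub_self, sub_zero,
      zero_sub, hf.neg_eq_conj, map_one, map_div₀, map_neg, Complex.conj_conj, Complex.conj_ofReal]
    field_simp
    linear_combination (-2 * (‖f x‖ : ℂ)) * h1 + f 0 * h1
  rw [quadForm, e] at h
  simp at h
  linarith

/-- The double integral of a positive semidefinite kernel with bounded diagonal against a
probability measure is nonnegative. -/
lemma re_integral_prod_nonneg {μ : Measure ℝ} [IsProbabilityMeasure μ] {H : ℝ → ℝ → ℂ} {M : ℝ}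
    (hint : Integrable (fun p : ℝ × ℝ => H p.1 p.2) (μ.prod μ)) (hdiag : ∀ x, (H x x).re ≤ M)
    (hpsd : ∀ (n : ℕ) (x : Fin n → ℝ), 0 ≤ (∑ i, ∑ j, H (x i) (x j)).re) :
    0 ≤ (∫ p, H p.1 p.2 ∂μ.prod μ).re := by
  set I := (∫ p, H p.1 p.2 ∂μ.prod μ).re with hI
  -- Integrate the form over `n` independent samples: each off-diagonal pair contributes `I`, the
  -- diagonal at most `n * M`, which is negligible against `n ^ 2`.
  have key : ∀ n : ℕ, -(n * M) ≤ (n * n - n) * I := by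
    intro n
    set P : Measure (Fin n → ℝ) := Measure.pi fun _ => μ
    have hmp : ∀ i j : Fin n, i ≠ j →
        MeasurePreserving (fun x : Fin n → ℝ => (x i, x j)) P (μ.prod μ) := by
      intro i j hij
      refine ⟨by fun_prop, ?_⟩
      have h1 := (ProbabilityTheory.iIndepFun_pi (μ := fun _ : Fin n => μ)
        (X := fun _ => id) (fun _ => aemeasurable_id)).indepFun hij
      have h2 := (ProbabilityTheory.indepFun_iff_map_prod_eq_prod_map_map
        (measurable_pi_apply i).aemeasurable (measurable_pi_apply j).aemeasurable).1 h1
      rw [h2, (measurePreserving_eval (fun _ : Fin n => μ) i).map_eq,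
        (measurePreserving_eval (fun _ : Fin n => μ) j).map_eq]
    have hint' : ∀ i j : Fin n, i ≠ j → Integrable (fun x : Fin n → ℝ => H (x i) (x j)) P :=
      fun i j hij => (hmp i j hij).integrable_comp_of_integrable hint
    have hval : ∀ i j : Fin n, i ≠ j → ∫ x, (H (x i) (x j)).re ∂P = I := by
      intro i j hij
      have h3 : ∫ x, H (x i) (x j) ∂P = ∫ p, H p.1 p.2 ∂μ.prod μ := by
        rw [← (hmp i j hij).map_eq, integral_map (by fun_prop)]
        rw [(hmp i j hij).map_eq]; exact hint.1
      rw [hI, ← h3]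
      exact integral_re (hint' i j hij)
    have hpt : ∀ x : Fin n → ℝ, -(n * M)
        ≤ ∑ i, ∑ j ∈ Finset.univ.erase i, (H (x i) (x j)).re := by
      intro x
      have h4 := hpsd n x
      have h5 : ∀ i, ∑ j, (H (x i) (x j)).re
          = (H (x i) (x i)).re + ∑ j ∈ Finset.univ.erase i, (H (x i) (x j)).re := fun i =>
        (Finset.add_sum_erase _ _ (Finset.mem_univ i)).symm
      simp only [Complex.re_sum, h5, Finset.sum_add_distrib] at h4
      have h6 : ∑ i, (H (x i) (x i)).re ≤ n * M := by
        refine (Finset.sum_le_sum fun i _ => hdiag (x i)).trans (by simp)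
      linarith
    have hre : ∀ i, ∀ j ∈ Finset.univ.erase i,
        Integrable (fun x : Fin n → ℝ => (H (x i) (x j)).re) P := fun i j hj =>
      (hint' i j (Finset.ne_of_mem_erase hj).symm).re
    have h7 : ∫ _ : Fin n → ℝ, -(n * M) ∂P
        ≤ ∫ x, ∑ i, ∑ j ∈ Finset.univ.erase i, (H (x i) (x j)).re ∂P :=
      integral_mono (integrable_const _)
        (integrable_finsetSum _ fun i _ => integrable_finsetSum _ fun j hj => hre i j hj) hpt
    rw [integral_finsetSum _ fun i _ => integrable_finsetSum _ fun j hj => hre i j hj] at h7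
    simp_rw [integral_finsetSum _ (hre _)] at h7
    rw [Finset.sum_congr rfl fun i _ => Finset.sum_congr rfl fun j hj =>
      hval i j (Finset.ne_of_mem_erase hj).symm] at h7
    simp only [integral_const, Finset.sum_const, Finset.card_erase_of_mem (Finset.mem_univ _),
      Finset.card_univ, Fintype.card_fin, probReal_univ, smul_eq_mul, one_mul,
      nsmul_eq_mul] at h7
    rcases Nat.eq_zero_or_pos n with rfl | hn
    · simp
    · rw [Nat.cast_sub hn] at h7
      push_cast at h7
      linarith
  by_contra! hneg
  obtain ⟨n, hn⟩ := exists_nat_gt (M / (-I) + 1)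
  have hpos : 0 < -I := by linarith
  have hn' : M < (n - 1) * (-I) := by
    rw [← div_lt_iff₀ hpos]; linarith
  have hM : 0 ≤ M + 0 := by
    have := key 1
    have h8 := hpsd 1 (fun _ => 0)
    simp at h8
    linarith [hdiag 0]
  have hn0 : (0 : ℝ) < n := by
    have : 0 ≤ M / (-I) := by rw [add_zero] at hM; positivity
    linarith
  nlinarith [key n]

/-! ### Fourier transforms that are nonnegative. -/

section Fourier

open FourierTransform

variable {F G : ℝ → ℂ}

lemma Real.integral_fourier_mul (hF : Integrable F) (hG : Integrable G) :
    ∫ ξ, 𝓕 F ξ * G ξ = ∫ x, F x * 𝓕 G x := by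
  simpa using! VectorFourier.integral_fourierIntegral_smul_eq_flip (L := innerₗ ℝ)
    Real.continuous_fourierChar continuous_inner hF hG

lemma Real.continuous_fourier (hF : Integrable F) : Continuous (𝓕 F) :=
  VectorFourier.fourierIntegral_continuous Real.continuous_fourierChar
    (L := innerₗ ℝ) continuous_inner hF

lemma Real.norm_fourier_le (F : ℝ → ℂ) (ξ : ℝ) : ‖𝓕 F ξ‖ ≤ ∫ x, ‖F x‖ :=
  VectorFourier.norm_fourierIntegral_le_integral_norm _ _ _ _ _

/-- A bounded integrable function with nonnegative Fourier transform has an integrable Fourier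
transform. -/
lemma integrable_fourier_of_nonneg (hF : Integrable F) {M : ℝ} (hM : ∀ x, ‖F x‖ ≤ M)
    (hpos : ∀ ξ, 0 ≤ 𝓕 F ξ) : Integrable (𝓕 F) := by
  set b : ℕ → ℝ := fun n => 1 / ((n : ℝ) + 1) with hb
  have hb0 : ∀ n, 0 < b n := fun n => by positivity
  set g : ℕ → ℝ → ℂ := fun n x => Complex.exp (-Real.pi * (b n : ℂ) * x ^ 2) with hg
  have hgreal : ∀ n x, g n x = (Real.exp (-(Real.pi * b n) * x ^ 2) : ℂ) := fun n x => by
    simp [hg]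
  have hgint : ∀ n, Integrable (g n) := fun n => by
    simp_rw [funext (hgreal n)]
    exact (integrable_exp_neg_mul_sq (mul_pos Real.pi_pos (hb0 n))).ofReal
  have hcont := Real.continuous_fourier hF
  have hprod : ∀ n, Integrable fun ξ => 𝓕 F ξ * g n ξ := fun n =>
    (hgint n).bdd_mul (c := ∫ x, ‖F x‖) hcont.aestronglyMeasurable
      (ae_of_all _ (Real.norm_fourier_le F))
  have hM0 : 0 ≤ M := (norm_nonneg _).trans (hM 0)
  -- Positivity turns the norm into the integrand; the multiplication formula moves the transform
  -- onto the Gaussian, where it has `L¹` norm `1`. Fatou's lemma then removes the Gaussian.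
  have hbound : ∀ n, ∫ ξ, ‖𝓕 F ξ * g n ξ‖ ≤ M := by
    intro n
    have h1 : ∀ ξ, ‖𝓕 F ξ * g n ξ‖ = (𝓕 F ξ * g n ξ).re := fun ξ => by
      have : 0 ≤ 𝓕 F ξ * g n ξ := by
        refine mul_nonneg (hpos ξ) ?_
        rw [hgreal]; exact_mod_cast (Real.exp_pos _).le
      rw [← Complex.norm_of_nonneg' this]
      simp
    have h2 : ∫ x, ‖𝓕 (g n) x‖ = 1 := by
      have h3 : ∀ x, ‖𝓕 (g n) x‖ = 1 / Real.sqrt (b n) * Real.exp (-(Real.pi / b n) * x ^ 2) := by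
        intro x
        rw [hg]
        simp only
        rw [fourier_gaussian_pi (by simpa using hb0 n)]
        simp only [norm_mul, norm_div, norm_one, Complex.norm_exp]
        rw [Complex.norm_cpow_eq_rpow_re_of_pos (hb0 n), Real.sqrt_eq_rpow]
        congr 2
        · norm_num
        · rw [← Complex.ofReal_pow, ← Complex.ofReal_neg, ← Complex.ofReal_div,
            ← Complex.ofReal_mul, Complex.ofReal_re]
          ring
      simp_rw [h3]
      rw [integral_const_mul, integral_gaussian]
      have : Real.pi / (Real.pi / b n) = b n := by
        field_simp
      rw [this]
      field_simp [(Real.sqrt_pos.2 (hb0 n)).ne']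
    have h4 : Integrable fun x => ‖𝓕 (g n) x‖ := by
      -- A non-integrable function would have integral `0` by convention, not `1`.
      by_contra h
      rw [integral_undef h] at h2
      exact zero_ne_one h2
    calc ∫ ξ, ‖𝓕 F ξ * g n ξ‖ = (∫ ξ, 𝓕 F ξ * g n ξ).re := by
          simp_rw [h1]; exact integral_re (hprod n)
      _ = (∫ x, F x * 𝓕 (g n) x).re := by rw [Real.integral_fourier_mul hF (hgint n)]
      _ ≤ ‖∫ x, F x * 𝓕 (g n) x‖ := Complex.re_le_norm _
      _ ≤ ∫ x, M * ‖𝓕 (g n) x‖ := by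
          refine norm_integral_le_of_norm_le (h4.const_mul M) (ae_of_all _ fun x => ?_)
          rw [norm_mul]; gcongr; exact hM x
      _ = M := by rw [integral_const_mul, h2, mul_one]
  refine ⟨hcont.aestronglyMeasurable, ?_⟩
  have hlim : ∀ ξ, Tendsto (fun n => ‖𝓕 F ξ * g n ξ‖ₑ) atTop (𝓝 ‖𝓕 F ξ‖ₑ) := by
    intro ξ
    have h5 : Tendsto (fun n => 𝓕 F ξ * g n ξ) atTop
        (𝓝 (𝓕 F ξ * Complex.exp (-Real.pi * ((0 : ℝ) : ℂ) * ξ ^ 2))) := by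
      have h6 : Tendsto b atTop (𝓝 0) := tendsto_one_div_add_atTop_nhds_zero_nat
      have h7 : Continuous fun t : ℝ => 𝓕 F ξ * Complex.exp (-Real.pi * (t : ℂ) * ξ ^ 2) := by
        fun_prop
      exact (h7.tendsto 0).comp h6
    simpa using h5.enorm
  calc ∫⁻ ξ, ‖𝓕 F ξ‖ₑ = ∫⁻ ξ, liminf (fun n => ‖𝓕 F ξ * g n ξ‖ₑ) atTop :=
        lintegral_congr fun ξ => (hlim ξ).liminf_eq.symm
    _ ≤ liminf (fun n => ∫⁻ ξ, ‖𝓕 F ξ * g n ξ‖ₑ) atTop := by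
        refine lintegral_liminf_le fun n => ?_
        have : Continuous fun ξ => 𝓕 F ξ * g n ξ := hcont.mul (by simp only [hg]; fun_prop)
        exact this.enorm.measurable
    _ ≤ ENNReal.ofReal M := by
        refine liminf_le_of_le (by isBoundedDefault) fun a ha => ?_
        obtain ⟨n, hn⟩ := ha.exists
        refine hn.trans ?_
        rw [← ofReal_integral_norm_eq_lintegral_enorm (hprod n)]
        exact ENNReal.ofReal_le_ofReal (hbound n)
    _ < ⊤ := ENNReal.ofReal_lt_top

/-- Fourier inversion almost everywhere, without continuity. -/
lemma fourierInv_fourier_ae_eq (hF : Integrable F) (hF' : Integrable (𝓕 F)) :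
    ∀ᵐ x, F x = 𝓕⁻ (𝓕 F) x := by
  have hc : Continuous (𝓕⁻ (𝓕 F)) := by
    have : 𝓕⁻ (𝓕 F) = fun x => 𝓕 (𝓕 F) (-x) := funext fun x => Real.fourierInv_eq_fourier_neg _ _
    rw [this]
    exact (Real.continuous_fourier hF').comp continuous_neg
  refine ae_eq_of_integral_contDiff_smul_eq hF.locallyIntegrable hc.locallyIntegrable
    fun ψ hψ hψc => ?_
  have hψc' : HasCompactSupport fun x => (ψ x : ℂ) := hψc.comp_left (g := ((↑) : ℝ → ℂ)) rfl
  set s : SchwartzMap ℝ ℂ := hψc'.toSchwartzMap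
    (Complex.ofRealCLM.contDiff.comp hψ) with hs
  have hs' : ∀ x, s x = ψ x := fun x => rfl
  have h1 : ∀ x, s x = 𝓕 (𝓕⁻ s : SchwartzMap ℝ ℂ) x := fun x => by
    rw [fourier_fourierInv_eq]
  set χ : SchwartzMap ℝ ℂ := 𝓕⁻ s with hχ
  have h2 : ∀ x, (ψ x : ℂ) = 𝓕 (χ : ℝ → ℂ) x := fun x => by
    rw [← hs', h1, SchwartzMap.fourier_coe]
  have h3 : ∀ ξ, (χ ξ : ℂ) = 𝓕 (s : ℝ → ℂ) (-ξ) := fun ξ => by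
    rw [hχ, SchwartzMap.fourierInv_coe, Real.fourierInv_eq_fourier_neg]
  -- Duality: the test function is a Fourier transform, and the multiplication formula is applied
  -- twice.
  calc ∫ x, ψ x • F x = ∫ x, F x * 𝓕 (χ : ℝ → ℂ) x := by
        refine integral_congr_ae (ae_of_all _ fun x => ?_)
        simp only [Complex.real_smul, h2]; ring
    _ = ∫ ξ, 𝓕 F ξ * χ ξ := (Real.integral_fourier_mul hF χ.integrable).symm
    _ = ∫ ξ, 𝓕 F ξ * 𝓕 (fun x => s (-x)) ξ := by
        refine integral_congr_ae (ae_of_all _ fun ξ => ?_)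
        simp only [h3]
        congr 1
        rw [Real.fourier_real_eq_integral_exp_smul, Real.fourier_real_eq_integral_exp_smul,
          ← integral_neg_eq_self]
        refine integral_congr_ae (ae_of_all _ fun x => ?_)
        simp
    _ = ∫ x, 𝓕 (𝓕 F) x * s (-x) := (Real.integral_fourier_mul hF' s.integrable.comp_neg).symm
    _ = ∫ x, ψ x • 𝓕⁻ (𝓕 F) x := by
        rw [← integral_neg_eq_self]
        refine integral_congr_ae (ae_of_all _ fun x => ?_)
        simp only [neg_neg, hs', Complex.real_smul, Real.fourierInv_eq_fourier_neg]
        ring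

/-- A bounded integrable function with nonnegative Fourier transform is almost everywhere the
characteristic function of a finite measure. -/
lemma exists_charFun_of_fourier_nonneg (hF : Integrable F) {M : ℝ} (hM : ∀ x, ‖F x‖ ≤ M)
    (hpos : ∀ ξ, 0 ≤ 𝓕 F ξ) :
    ∃ μ : Measure ℝ, IsFiniteMeasure μ ∧ ∀ᵐ x, F x = charFun μ x := by
  have hint := integrable_fourier_of_nonneg hF hM hpos
  set d : ℝ → ℝ := fun ξ => (𝓕 F ξ).re with hd
  have hd0 : ∀ ξ, 0 ≤ d ξ := fun ξ => (Complex.le_def.1 (hpos ξ)).1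
  have hdF : ∀ ξ, (d ξ : ℂ) = 𝓕 F ξ := fun ξ =>
    Complex.ext rfl (by simpa using (Complex.le_def.1 (hpos ξ)).2)
  have hdm : Measurable d := by
    exact (Complex.continuous_re.comp (Real.continuous_fourier hF)).measurable
  set ν : Measure ℝ := volume.withDensity fun ξ => ENNReal.ofReal (d ξ) with hν
  have hfin : IsFiniteMeasure ν := isFiniteMeasure_withDensity_ofReal hint.re.2
  -- The dilation reconciles the kernel `e^{2πixξ}` of `𝓕⁻` with `e^{ixξ}` in `charFun`.
  refine ⟨ν.map (2 * Real.pi * ·), inferInstance, ?_⟩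
  filter_upwards [fourierInv_fourier_ae_eq hF hint] with x hx
  rw [hx, charFun_map_mul, charFun_apply_real, hν,
    integral_withDensity_eq_integral_toReal_smul (by fun_prop) (by simp), Real.fourierInv_eq']
  refine integral_congr_ae (ae_of_all _ fun ξ => ?_)
  simp only [ENNReal.toReal_ofReal (hd0 ξ), Complex.real_smul, hdF, smul_eq_mul]
  rw [mul_comm]
  congr 2
  simp
  ring

end Fourier

/-! ### Bochner's theorem without continuity. -/

namespace IsPositiveDefiniteFun

open ProbabilityTheory FourierTransform
open scoped NNReal

variable {f : ℝ → ℂ}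

/-- A centred Gaussian of variance `2v` is the law of a difference of two independent ones of
variance `v`, so the integral is a double integral of the positive definite kernel `k (x - y)`. Its
imaginary part vanishes by symmetry. -/
lemma integral_gaussianReal_nonneg (hf : IsPositiveDefiniteFun f) (hm : AEMeasurable f)
    {v : ℝ≥0} (hv : v ≠ 0) (t : ℝ) :
    0 ≤ ∫ u, Complex.exp (-(t * u : ℝ) * Complex.I) * f u ∂gaussianReal 0 (v + v) := by
  set γ := gaussianReal 0 v with hγ
  set k : ℝ → ℂ := fun u => Complex.exp (-(t * u : ℝ) * Complex.I) * f u with hk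
  have hsub : (γ.prod γ).map (fun p : ℝ × ℝ => p.1 - p.2) = gaussianReal 0 (v + v) := by
    have h1 : γ.conv (γ.map fun x => -x) = gaussianReal 0 (v + v) := by
      rw [hγ, gaussianReal_map_neg, gaussianReal_conv_gaussianReal]; simp
    rw [← h1, Measure.conv]
    have h2 : γ.prod (γ.map fun x => -x) = (γ.prod γ).map (Prod.map id fun x => -x) := by
      rw [← Measure.map_prod_map γ γ measurable_id measurable_neg, Measure.map_id]
    rw [h2, Measure.map_map (by fun_prop) (by fun_prop)]
    rfl
  have hvv : v + v ≠ 0 := by simpa using hv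
  have hkm : AEMeasurable k (gaussianReal 0 (v + v)) := by
    have : AEMeasurable f (gaussianReal 0 (v + v)) :=
      hm.mono_ac (gaussianReal_absolutelyContinuous _ hvv)
    fun_prop
  have hkb : ∀ u, ‖k u‖ ≤ (f 0).re := fun u => by
    rw [hk]
    simp only [norm_mul]
    rw [Complex.norm_exp]
    simpa using hf.norm_le u
  have hkint : Integrable k (gaussianReal 0 (v + v)) :=
    (integrable_const ((f 0).re)).mono' hkm.aestronglyMeasurable (ae_of_all _ hkb)
  have hksub : ∫ u, k u ∂gaussianReal 0 (v + v) = ∫ p : ℝ × ℝ, k (p.1 - p.2) ∂γ.prod γ := by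
    rw [← hsub, integral_map (by fun_prop)]
    rw [hsub]; exact hkm.aestronglyMeasurable
  rw [Complex.le_def]
  refine ⟨?_, ?_⟩
  · change 0 ≤ (∫ u, k u ∂gaussianReal 0 (v + v)).re
    rw [hksub]
    refine re_integral_prod_nonneg (H := fun x y => k (x - y)) (M := (f 0).re) ?_ ?_ ?_
    · rw [← hsub] at hkint
      exact hkint.comp_measurable (by fun_prop)
    · intro x; simp [hk]
    · intro n x
      refine (hf.quadForm_nonneg x fun j => Complex.exp ((t * x j : ℝ) * Complex.I)).trans_eq ?_
      rw [quadForm]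
      congr 1
      refine Finset.sum_congr rfl fun i _ => Finset.sum_congr rfl fun j _ => ?_
      rw [hk]
      simp only
      rw [← Complex.exp_conj, ← Complex.exp_add]
      congr 2
      simp only [map_mul, Complex.conj_ofReal, Complex.conj_I]
      push_cast; ring
  · have hneg : ∫ u, k u ∂gaussianReal 0 (v + v) = ∫ u, k (-u) ∂gaussianReal 0 (v + v) := by
      have h1 : (gaussianReal 0 (v + v)).map (fun x => -x) = gaussianReal 0 (v + v) := by
        rw [gaussianReal_map_neg, neg_zero]
      conv_lhs => rw [← h1]
      rw [integral_map (by fun_prop)]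
      rw [h1]; exact hkm.aestronglyMeasurable
    have hconj : ∀ u, k (-u) = conj (k u) := fun u => by
      simp only [hk, map_mul, hf.neg_eq_conj, ← Complex.exp_conj, map_neg, Complex.conj_ofReal,
        Complex.conj_I]
      congr 2
      push_cast; ring
    simp only [hconj] at hneg
    rw [integral_conj] at hneg
    exact (Complex.conj_eq_iff_im.1 hneg.symm).symm

lemma exists_charFun_mul_gaussian (hf : IsPositiveDefiniteFun f) (hm : AEMeasurable f)
    {b : ℝ} (hb : 0 < b) : ∃ μ : Measure ℝ, IsFiniteMeasure μ ∧
      ∀ᵐ x : ℝ, f x * Real.exp (-b * x ^ 2) = charFun μ x := by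
  have hgint : Integrable fun x : ℝ => (Real.exp (-b * x ^ 2) : ℂ) :=
    (integrable_exp_neg_mul_sq hb).ofReal
  have hexp : ∀ x : ℝ, Real.exp (-b * x ^ 2) ≤ 1 := fun x => by
    rw [Real.exp_le_one_iff]; nlinarith [sq_nonneg x]
  refine exists_charFun_of_fourier_nonneg (M := (f 0).re)
    (hgint.bdd_mul (c := (f 0).re) hm.aestronglyMeasurable (ae_of_all _ hf.norm_le)) ?_ ?_
  · intro x
    rw [norm_mul, Complex.norm_real, Real.norm_of_nonneg (Real.exp_pos _).le]
    exact (mul_le_of_le_one_right (norm_nonneg _) (hexp x)).trans (hf.norm_le x)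
  · intro ξ
    -- Variance `v + v = 1 / (2b)` gives a density proportional to `exp (-b x ^ 2)`.
    set v : ℝ≥0 := ⟨1 / (4 * b), by positivity⟩ with hv
    have hvb : (v : ℝ) = 1 / (4 * b) := rfl
    have hv0 : v ≠ 0 := by
      rw [← NNReal.coe_ne_zero, hvb]; positivity
    have h := hf.integral_gaussianReal_nonneg hm hv0 (2 * Real.pi * ξ)
    rw [integral_gaussianReal_eq_integral_smul (by simpa using hv0)] at h
    set C : ℝ := Real.sqrt (2 * Real.pi * ((v + v : ℝ≥0) : ℝ)) with hC
    have hC0 : 0 < C := Real.sqrt_pos.2 (by rw [NNReal.coe_add, hvb]; positivity)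
    have e : 𝓕 (fun x => f x * (Real.exp (-b * x ^ 2) : ℂ)) ξ = (C : ℂ) *
        ∫ u, gaussianPDFReal 0 (v + v) u • (Complex.exp (-(2 * Real.pi * ξ * u : ℝ) * Complex.I)
          * f u) := by
      rw [Real.fourier_real_eq_integral_exp_smul, ← integral_const_mul]
      refine integral_congr_ae (ae_of_all _ fun u => ?_)
      have h1 : C * gaussianPDFReal 0 (v + v) u = Real.exp (-b * u ^ 2) := by
        rw [gaussianPDFReal_def]
        simp only
        rw [← hC, mul_inv_cancel_left₀ hC0.ne', NNReal.coe_add, hvb]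
        congr 1
        field_simp
        ring
      simp only [Complex.real_smul, smul_eq_mul]
      rw [← mul_assoc (C : ℂ), ← Complex.ofReal_mul, h1]
      have : ((-2 * Real.pi * u * ξ : ℝ) : ℂ) = -((2 * Real.pi * ξ * u : ℝ) : ℂ) := by
        push_cast; ring
      rw [this]
      ring
    rw [e]
    exact mul_nonneg (by exact_mod_cast hC0.le) h

/-- **Bochner's theorem** for measurable positive definite functions. -/
theorem exists_ae_eq_charFun (hf : IsPositiveDefiniteFun f) (hm : AEMeasurable f) :
    ∃ μ : Measure ℝ, IsFiniteMeasure μ ∧ ∀ᵐ x : ℝ, f x = charFun μ x := by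
  have hb : ∀ n : ℕ, (0 : ℝ) < 1 / ((n : ℝ) + 1) := fun n => by positivity
  choose μ hμfin hμ using fun n : ℕ => hf.exists_charFun_mul_gaussian hm (hb n)
  -- The continuous representative of `f`: the factor undoes the Gaussian of index `0`, where `b =
  -- 1`.
  set Θ : ℝ → ℂ := fun x => charFun (μ 0) x * Real.exp (x ^ 2) with hΘ
  have hΘc : Continuous Θ := by
    have := continuous_charFun (μ := μ 0)
    fun_prop
  have hΘf : ∀ᵐ x, f x = Θ x := by
    filter_upwards [hμ 0] with x hx
    rw [hΘ]
    simp only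
    rw [← hx, mul_assoc, ← Complex.ofReal_mul, ← Real.exp_add]
    simp
  have hΘn : ∀ n x, charFun (μ n) x = Θ x * Real.exp (-(1 / ((n : ℝ) + 1)) * x ^ 2) := by
    intro n
    have h1 : Continuous fun x : ℝ => Θ x * (Real.exp (-(1 / ((n : ℝ) + 1)) * x ^ 2) : ℂ) := by
      fun_prop
    refine congrFun ((Continuous.ae_eq_iff_eq volume continuous_charFun h1).1 ?_)
    filter_upwards [hμ n, hΘf] with x hx hx'
    rw [← hx, hx']
  have hlim : ∀ x, Tendsto (fun n => charFun (μ n) x) atTop (𝓝 (Θ x)) := by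
    intro x
    simp_rw [hΘn]
    have h1 : Continuous fun s : ℝ => Θ x * (Real.exp (-s * x ^ 2) : ℂ) := by fun_prop
    have h2 := (h1.tendsto 0).comp (tendsto_one_div_add_atTop_nhds_zero_nat (𝕜 := ℝ))
    simpa [Function.comp_def] using h2
  set m : ℝ := (μ 0).real Set.univ with hm'
  have hmass : ∀ n, (μ n).real Set.univ = m := by
    intro n
    have h1 := hΘn n 0
    have h2 := hΘn 0 0
    rw [charFun_zero] at h1 h2
    have : (((μ n).real Set.univ : ℝ) : ℂ) = ((μ 0).real Set.univ : ℝ) := by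
      rw [h1, h2]; simp
    exact_mod_cast this
  rcases (measureReal_nonneg : 0 ≤ (μ 0).real Set.univ).eq_or_lt with h0 | h0
  · refine ⟨0, inferInstance, ?_⟩
    have hμ0 : μ 0 = 0 := by
      rw [← Measure.measure_univ_eq_zero]
      exact (measureReal_eq_zero_iff).1 h0.symm
    filter_upwards [hΘf] with x hx
    rw [hx, hΘ, hμ0]; simp
  · have hm0 : 0 < m := h0
    set ν : ℕ → Measure ℝ := fun n => ENNReal.ofReal m⁻¹ • μ n with hν
    have hνc : ∀ n x, charFun (ν n) x = (m⁻¹ : ℝ) * charFun (μ n) x := by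
      intro n x
      rw [charFun_apply_real, charFun_apply_real, hν]
      simp only
      rw [integral_smul_measure, ENNReal.toReal_ofReal (inv_pos.2 hm0).le, Complex.real_smul]
    have hνp : ∀ n, IsProbabilityMeasure (ν n) := fun n => by
      refine ⟨?_⟩
      rw [hν]
      simp only [Measure.smul_apply, smul_eq_mul]
      have : μ n Set.univ = ENNReal.ofReal m := by
        rw [← hmass n, measureReal_def, ENNReal.ofReal_toReal (measure_ne_top _ _)]
      rw [this, ← ENNReal.ofReal_mul (inv_pos.2 hm0).le, inv_mul_cancel₀ hm0.ne',
        ENNReal.ofReal_one]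
    have hνlim : ∀ x, Tendsto (fun n => charFun (ν n) x) atTop (𝓝 ((m⁻¹ : ℝ) * Θ x)) := by
      intro x
      simp_rw [hνc]
      exact (hlim x).const_mul _
    -- Lévy's argument: continuity of the limit gives tightness, and a limit along an ultrafilter
    -- replaces the extraction of a subsequence.
    have htight := isTightMeasureSet_of_tendsto_charFun
      (f := fun x => ((m⁻¹ : ℝ) : ℂ) * Θ x) (by fun_prop) hνlim
    set νP : ℕ → ProbabilityMeasure ℝ := fun n => ⟨ν n, hνp n⟩ with hνP
    have hcpt : IsCompact (closure (Set.range νP)) := by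
      refine isCompact_closure_of_isTightMeasureSet ?_
      convert! htight using 1
      ext ρ
      constructor
      · rintro ⟨_, ⟨n, rfl⟩, rfl⟩; exact ⟨n, rfl⟩
      · rintro ⟨n, rfl⟩; exact ⟨_, ⟨n, rfl⟩, rfl⟩
    set U : Ultrafilter ℕ := hyperfilter ℕ with hU
    have hUle : (U : Filter ℕ) ≤ atTop := by
      rw [hU, ← Nat.cofinite_eq_atTop]; exact hyperfilter_le_cofinite
    obtain ⟨ρ, -, hρ⟩ := hcpt.ultrafilter_le_nhds (U.map νP) (by
      rw [Ultrafilter.coe_map, le_principal_iff]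
      exact mem_map.2 (Eventually.of_forall fun n => subset_closure ⟨n, rfl⟩))
    have hρ' : Tendsto νP U (𝓝 ρ) := hρ
    have hρc : ∀ x, charFun (ρ : Measure ℝ) x = (m⁻¹ : ℝ) * Θ x := by
      intro x
      rw [ProbabilityMeasure.tendsto_iff_forall_integral_rclike_tendsto ℂ] at hρ'
      have h1 := hρ' (BoundedContinuousFunction.innerProbChar x)
      simp_rw [← charFun_eq_integral_innerProbChar] at h1
      exact tendsto_nhds_unique h1 ((hνlim x).mono_left hUle)
    refine ⟨ENNReal.ofReal m • (ρ : Measure ℝ),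
      Measure.smul_finite _ ENNReal.ofReal_ne_top, ?_⟩
    filter_upwards [hΘf] with x hx
    rw [hx, charFun_apply_real, integral_smul_measure, ← charFun_apply_real, hρc,
      ENNReal.toReal_ofReal hm0.le, Complex.real_smul, ← mul_assoc, ← Complex.ofReal_mul,
      mul_inv_cancel₀ hm0.ne', Complex.ofReal_one, one_mul]

end IsPositiveDefiniteFun

/-! ### Continuous parts, and measurability from the real part. -/

namespace IsPositiveDefiniteFun

variable {f : ℝ → ℂ}

/-- At `t = 0` this function is the form of `f` itself, so the sup bound on it compares forms.
Positivity comes from product weights at the points `s a + x i`. -/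
lemma sum_translate (hf : IsPositiveDefiniteFun f) {ι : Type*} [Fintype ι] (x : ι → ℝ)
    (c : ι → ℂ) :
    IsPositiveDefiniteFun fun t => ∑ i, ∑ j, conj (c i) * c j * f (x i - x j + t) := by
  refine of_quadForm (fun t => ?_) fun n s w => ?_
  · conv_lhs => rw [Finset.sum_comm]
    simp only [map_sum, map_mul, ← hf.neg_eq_conj, Complex.conj_conj]
    refine Finset.sum_congr rfl fun i _ => Finset.sum_congr rfl fun j _ => ?_
    rw [show -(x i - x j + t) = x j - x i + -t by ring]
    ring
  · refine (hf.quadForm_nonneg (fun p : Fin n × ι => s p.1 + x p.2)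
      (fun p => w p.1 * c p.2)).trans_eq ?_
    rw [quadForm, quadForm]
    congr 1
    simp only [Fintype.sum_prod_type, Finset.mul_sum]
    refine Finset.sum_congr rfl fun a _ => ?_
    rw [Finset.sum_comm]
    refine Finset.sum_congr rfl fun b _ => Finset.sum_congr rfl fun i _ =>
      Finset.sum_congr rfl fun j _ => ?_
    rw [map_mul, show s a + x i - (s b + x j) = x i - x j + (s a - s b) by ring]
    ring

lemma norm_le_of_ae_eq (hf : IsPositiveDefiniteFun f) {h : ℝ → ℂ} (hc : Continuous h)
    (hae : ∀ᵐ x, f x = h x) (x : ℝ) : ‖h x‖ ≤ (f 0).re := by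
  have hd : Dense {x | f x = h x} := Measure.dense_of_ae hae
  have hcl : IsClosed {x | ‖h x‖ ≤ (f 0).re} := isClosed_le hc.norm continuous_const
  have hsub : {x | f x = h x} ⊆ {x | ‖h x‖ ≤ (f 0).re} := fun y hy => by
    have hy' : f y = h y := hy
    change ‖h y‖ ≤ _
    rw [← hy']; exact hf.norm_le y
  exact hcl.closure_subset_iff.2 hsub (hd x)

/-- Removing the continuous part of a measurable positive definite function leaves a positive
definite function. -/
theorem sub_of_ae_eq (hf : IsPositiveDefiniteFun f) {h : ℝ → ℂ} (hc : Continuous h)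
    (hneg : ∀ x, h (-x) = conj (h x)) (hae : ∀ᵐ x, f x = h x) :
    IsPositiveDefiniteFun fun x => f x - h x := by
  refine of_quadForm (fun x => by rw [hf.neg_eq_conj, hneg, map_sub]) fun n x c => ?_
  rw [quadForm_sub, sub_nonneg]
  -- The continuous version of the translated sum is bounded by the value of the original at `0`;
  -- its own value at `0` is the form of `h`.
  have h1 := (hf.sum_translate x c).norm_le_of_ae_eq
    (h := fun t => ∑ i, ∑ j, conj (c i) * c j * h (x i - x j + t)) (by fun_prop) (by
      have h2 : ∀ i j, ∀ᵐ t, f (x i - x j + t) = h (x i - x j + t) := fun i j =>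
        (measurePreserving_add_left volume (x i - x j)).quasiMeasurePreserving.ae hae
      filter_upwards [ae_all_iff.2 fun i => ae_all_iff.2 (h2 i)] with t ht
      simp only [ht]) 0
  simp only [add_zero] at h1
  exact (Complex.re_le_norm _).trans h1

/-- The extra point `0` with weight `i l` makes the cross terms read off the imaginary part. -/
lemma quadForm_sub_two_mul_im_nonneg (hf : IsPositiveDefiniteFun f) {ι : Type*} [Fintype ι]
    (x : ι → ℝ) (c : ι → ℝ) (l : ℝ) :
    0 ≤ quadForm f x (fun i => c i) - 2 * l * ∑ i, c i * (f (x i)).im + l ^ 2 * (f 0).re := by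
  have h := hf.quadForm_nonneg (ι := Option ι) (fun o => o.elim 0 x)
    (fun o => o.elim (l * Complex.I) fun i => c i)
  simp only [quadForm, Fintype.sum_option, Option.elim_none, Option.elim_some,
    Finset.sum_add_distrib, sub_zero, zero_sub] at h
  have e1 : (∑ i, conj (l * Complex.I) * (c i : ℂ) * f (-x i)).re = - l * ∑ i, c i * (f (x i)).im := by
    rw [Complex.re_sum, Finset.mul_sum]
    refine Finset.sum_congr rfl fun i _ => ?_
    simp [hf.neg_eq_conj]
    ring
  have e2 : (∑ i, conj ((c i : ℂ)) * (l * Complex.I) * f (x i)).re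
      = - l * ∑ i, c i * (f (x i)).im := by
    rw [Complex.re_sum, Finset.mul_sum]
    refine Finset.sum_congr rfl fun i _ => ?_
    simp
    ring
  have e3 : (conj (l * Complex.I) * (l * Complex.I) * f 0).re = l ^ 2 * (f 0).re := by
    simp [pow_two]
  rw [Complex.add_re, Complex.add_re, Complex.add_re, e1, e2, e3] at h
  rw [quadForm]
  linarith

/-- If the real part is almost everywhere equal to a continuous function, then on two sets of
positive outer measure contained in a short interval the imaginary part cannot be separated. -/
lemma im_separation_le (hf : IsPositiveDefiniteFun f) {r : ℝ → ℝ} (hr : 0 ≤ r 0)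
    (hae : ∀ᵐ x, (f x).re = r x) {κ η : ℝ} (hκ : ∀ t, |t| < η → |r t - r 0| ≤ κ)
    {A B : Set ℝ} (hA : volume A ≠ 0) (hB : volume B ≠ 0)
    (hAA : ∀ s ∈ A, ∀ t ∈ A, |s - t| < η) (hAB : ∀ s ∈ A, ∀ t ∈ B, |s - t| < η)
    (hBB : ∀ s ∈ B, ∀ t ∈ B, |s - t| < η) {a b : ℝ} (ha : ∀ s ∈ A, a ≤ (f s).im)
    (hb : ∀ s ∈ B, (f s).im ≤ b) {l : ℝ} (hl : 0 ≤ l) :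
    2 * l * (a - b) ≤ 4 * κ + l ^ 2 * (f 0).re := by
  obtain ⟨x, y, hx, hy, hxx, hyy, hxy⟩ := exists_seq_pairs_sub_notMem hA hB (ae_iff.1 hae)
  simp only [Set.mem_ofPred_eq, not_not] at hxx hyy hxy
  have hf0 := hf.map_zero_nonneg
  have hκ0 : 0 ≤ κ := by
    obtain ⟨s, hs⟩ := nonempty_of_measure_ne_zero hA
    exact (abs_nonneg _).trans (hκ _ (hAA s hs s hs))
  have hdiag : ∀ (z : ℕ → ℝ), (∀ m n, |z m - z n| < η) →
      (∀ m n, m ≠ n → (f (z m - z n)).re = r (z m - z n)) → ∀ N : ℕ,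
      ∑ m : Fin N, ∑ n : Fin N, (f (z m - z n)).re ≤ N ^ 2 * (r 0 + κ) + N * (f 0).re := by
    intro z hz hz' N
    have h1 : ∀ m n : Fin N, (f (z m - z n)).re
        ≤ (r 0 + κ) + if m = n then (f 0).re else 0 := by
      intro m n
      split_ifs with hmn
      · subst hmn; rw [sub_self]; linarith
      · rw [hz' m n (fun h => hmn (Fin.ext h))]
        linarith [(abs_le.1 (hκ _ (hz m n))).2]
    refine (Finset.sum_le_sum fun m _ => Finset.sum_le_sum fun n _ => h1 m n).trans (le_of_eq ?_)
    simp [Finset.sum_add_distrib]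
    ring
  have hcross : ∀ N : ℕ, N ^ 2 * (r 0 - κ) ≤ ∑ m : Fin N, ∑ n : Fin N, (f (x m - y n)).re := by
    intro N
    have h1 : ∀ m n : Fin N, r 0 - κ ≤ (f (x m - y n)).re := by
      intro m n
      rw [hxy]
      linarith [(abs_le.1 (hκ _ (hAB _ (hx m) _ (hy n)))).1]
    refine (le_of_eq ?_).trans (Finset.sum_le_sum fun m _ => Finset.sum_le_sum fun n _ => h1 m n)
    simp
    ring
  -- Weights `1` on `N` points of `A` and `-1` on `N` points of `B`: off the diagonal the real parts
  -- nearly cancel, leaving at most `4κN² + 2N f(0)`. The scale `l * N` makes the other terms of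
  -- order `N²`.
  have key : ∀ N : ℕ, 0 < N →
      2 * l * (a - b) ≤ 4 * κ + l ^ 2 * (f 0).re + 2 * (f 0).re * (1 / N) := by
    intro N hN
    have hN' : (0 : ℝ) < N := by exact_mod_cast hN
    have h := hf.quadForm_sub_two_mul_im_nonneg (ι := Fin N ⊕ Fin N)
      (Sum.elim (fun k => x k) (fun k => y k)) (Sum.elim (fun _ => 1) (fun _ => -1)) (l * N)
    have hcross' : ∑ m : Fin N, ∑ n : Fin N, (f (y m - x n)).re
        = ∑ m : Fin N, ∑ n : Fin N, (f (x m - y n)).re := by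
      rw [Finset.sum_comm]
      refine Finset.sum_congr rfl fun m _ => Finset.sum_congr rfl fun n _ => ?_
      rw [← neg_sub, hf.neg_eq_conj, Complex.conj_re]
    have hq : quadForm f (Sum.elim (fun k : Fin N => x k) (fun k : Fin N => y k))
        (fun i => ((Sum.elim (fun _ => 1) (fun _ => -1) i : ℝ) : ℂ))
        = ∑ m : Fin N, ∑ n : Fin N, (f (x m - x n)).re
          + ∑ m : Fin N, ∑ n : Fin N, (f (y m - y n)).re
          - 2 * ∑ m : Fin N, ∑ n : Fin N, (f (x m - y n)).re := by
      simp only [quadForm, Fintype.sum_sum_type, Sum.elim_inl, Sum.elim_inr, Complex.re_sum,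
        Complex.add_re, Finset.sum_add_distrib, Complex.ofReal_one, Complex.ofReal_neg, map_one,
        map_neg, one_mul, mul_one, neg_mul, neg_neg, Complex.neg_re, Finset.sum_neg_distrib]
      rw [hcross']
      ring
    have hlin : N * (a - b) ≤ ∑ i : Fin N ⊕ Fin N, (Sum.elim (fun _ => 1) (fun _ => -1) i : ℝ)
        * (f (Sum.elim (fun k : Fin N => x k) (fun k : Fin N => y k) i)).im := by
      simp only [Fintype.sum_sum_type, Sum.elim_inl, Sum.elim_inr, one_mul, neg_mul,
        Finset.sum_neg_distrib]
      have h1 : ∑ _k : Fin N, a ≤ ∑ k : Fin N, (f (x k)).im :=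
        Finset.sum_le_sum fun k _ => ha _ (hx k)
      have h2 : ∑ k : Fin N, (f (y k)).im ≤ ∑ _k : Fin N, b :=
        Finset.sum_le_sum fun k _ => hb _ (hy k)
      simp at h1 h2
      linarith
    rw [hq] at h
    have hd1 := hdiag x (fun m n => hAA _ (hx m) _ (hx n)) hxx N
    have hd2 := hdiag y (fun m n => hBB _ (hy m) _ (hy n)) hyy N
    have hc := hcross N
    have hlin' := mul_le_mul_of_nonneg_left hlin (by positivity : 0 ≤ 2 * (l * N))
    have h3 : N ^ 2 * (2 * l * (a - b)) ≤ N ^ 2 * (4 * κ + l ^ 2 * (f 0).re)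
        + 2 * N * (f 0).re := by nlinarith
    have h4 : N ^ 2 * (4 * κ + l ^ 2 * (f 0).re) + 2 * N * (f 0).re
        = N ^ 2 * (4 * κ + l ^ 2 * (f 0).re + 2 * (f 0).re * (1 / N)) := by
      field_simp
    rw [h4] at h3
    exact le_of_mul_le_mul_left h3 (by positivity)
  have hlim : Tendsto (fun n : ℕ => 4 * κ + l ^ 2 * (f 0).re
      + 2 * (f 0).re * (1 / ((n : ℝ) + 1))) atTop
      (𝓝 (4 * κ + l ^ 2 * (f 0).re + 2 * (f 0).re * 0)) :=
    (tendsto_one_div_add_atTop_nhds_zero_nat.const_mul _).const_add _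
  have := ge_of_tendsto' hlim fun n => by
    have := key (n + 1) (Nat.succ_pos n)
    push_cast at this
    exact this
  simpa using this

/-- The constant is the essential infimum of `σ` on `I`, defined through null sets because `σ` is
not known to be measurable. -/
lemma exists_ae_close_const {I : Set ℝ} (hI : volume I ≠ 0) {σ : ℝ → ℝ} {M ε : ℝ} (hε : 0 < ε)
    (hM : ∀ t, |σ t| ≤ M)
    (hsep : ∀ a b : ℝ, volume (I ∩ {t | a ≤ σ t}) ≠ 0 → volume (I ∩ {t | σ t ≤ b}) ≠ 0 →
      a - b ≤ ε) : ∃ r : ℝ, volume (I ∩ {t | 2 * ε < |σ t - r|}) = 0 := by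
  set R : Set ℝ := {b | volume (I ∩ {t | σ t ≤ b}) = 0} with hR
  have hne : R.Nonempty := ⟨-M - 1, by
    have : I ∩ {t | σ t ≤ -M - 1} = ∅ := by
      ext t
      simp only [Set.mem_inter_iff, Set.mem_ofPred_eq, Set.mem_empty_iff_false, iff_false, not_and]
      intro _; linarith [(abs_le.1 (hM t)).1]
    change volume _ = 0
    rw [this, measure_empty]⟩
  have hbdd : BddAbove R := by
    refine ⟨M, fun b hb => ?_⟩
    by_contra! hlt
    have hsub : I ⊆ I ∩ {t | σ t ≤ b} := fun t ht =>
      ⟨ht, (abs_le.1 (hM t)).2.trans hlt.le⟩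
    exact hI (measure_mono_null hsub hb)
  refine ⟨sSup R, ?_⟩
  have h1 : volume (I ∩ {t | σ t ≤ sSup R - ε}) = 0 := by
    obtain ⟨b, hb, hlt⟩ := exists_lt_of_lt_csSup hne (by linarith : sSup R - ε < sSup R)
    refine measure_mono_null ?_ hb
    exact fun t ht => ⟨ht.1, le_trans ht.2 hlt.le⟩
  have h2 : volume (I ∩ {t | sSup R + 2 * ε ≤ σ t}) = 0 := by
    by_contra hcon
    -- The levels `sSup R + 2ε` and `sSup R + ε / 2` differ by `3ε / 2 > ε`, against `hsep`.
    have h3 : sSup R + ε / 2 ∉ R := fun h => by linarith [le_csSup hbdd h]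
    linarith [hsep _ _ hcon h3]
  refine measure_mono_null ?_ (measure_union_null h1 h2)
  rintro t ⟨htI, ht⟩
  have ht' : 2 * ε < |σ t - sSup R| := ht
  rcases lt_abs.1 ht' with h | h
  · exact Or.inr ⟨htI, by rw [Set.mem_ofPred_eq]; linarith⟩
  · exact Or.inl ⟨htI, by rw [Set.mem_ofPred_eq]; linarith⟩

/-- A positive definite function with measurable real part is measurable. -/
theorem aemeasurable_of_re (hf : IsPositiveDefiniteFun f)
    (hm : AEMeasurable fun x => (f x).re) : AEMeasurable f := by
  have hre : IsPositiveDefiniteFun fun x => ((f x).re : ℂ) := by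
    have := (hf.add hf.conj_fun).ofReal_mul (r := 1 / 2) (by norm_num)
    convert this using 2 with x
    rw [Complex.add_conj]; push_cast; ring
  obtain ⟨μ, _, hμ⟩ := hre.exists_ae_eq_charFun (Complex.measurable_ofReal.comp_aemeasurable hm)
  set r : ℝ → ℝ := fun t => (charFun μ t).re with hr
  have hrc : Continuous r := Complex.continuous_re.comp continuous_charFun
  have hr0 : 0 ≤ r 0 := by simp [hr]
  have hae : ∀ᵐ x, (f x).re = r x := by
    filter_upwards [hμ] with x hx
    rw [hr]; simp only [← hx, Complex.ofReal_re]
  have hf0 := hf.map_zero_nonneg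
  have hstep : ∀ ε : ℝ, 0 < ε → ∃ h : ℝ → ℝ, Measurable h ∧ ∀ᵐ t, |(f t).im - h t| ≤ 2 * ε := by
    intro ε hε
    -- Chosen so that `l ^ 2 * f(0) ≤ l * ε`; with `κ = l * ε / 4` the separation bound becomes `a -
    -- b ≤ ε`. On a grid of mesh `η`, a step function then approximates `Im f`.
    set l : ℝ := ε / ((f 0).re + 1) with hl
    have hl0 : 0 < l := by positivity
    have hlf : l * (f 0).re ≤ ε := by
      rw [hl, div_mul_eq_mul_div, div_le_iff₀ (by positivity)]; nlinarith
    obtain ⟨η, hη, hκ⟩ := Metric.continuousAt_iff.1 (hrc.continuousAt (x := 0)) (l * ε / 4)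
      (by positivity)
    have hκ' : ∀ t, |t| < η → |r t - r 0| ≤ l * ε / 4 := fun t ht => by
      have := hκ (x := t) (by simpa [Real.dist_eq] using ht)
      rw [Real.dist_eq] at this
      exact this.le
    have hloc : ∀ k : ℤ, ∃ c : ℝ,
        volume ({t | ⌊t / η⌋ = k} ∩ {t | 2 * ε < |(f t).im - c|}) = 0 := by
      intro k
      have hI : ({t : ℝ | ⌊t / η⌋ = k}) = Set.Ico (k * η) ((k + 1) * η) := by
        ext t
        rw [Set.mem_ofPred_eq, Int.floor_eq_iff, Set.mem_Ico, le_div_iff₀ hη, div_lt_iff₀ hη]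
      have hIdist : ∀ s ∈ {t : ℝ | ⌊t / η⌋ = k}, ∀ t ∈ {t : ℝ | ⌊t / η⌋ = k}, |s - t| < η := by
        rw [hI]
        intro s hs t ht
        rw [abs_lt]
        constructor <;> linarith [hs.1, hs.2, ht.1, ht.2]
      refine exists_ae_close_const (M := (f 0).re) ?_ hε
        (fun t => (Complex.abs_im_le_norm _).trans (hf.norm_le t)) fun a b ha hb => ?_
      · rw [hI, Real.volume_Ico]
        simp only [ne_eq, ENNReal.ofReal_eq_zero, not_le]
        linarith
      · have := hf.im_separation_le hr0 hae hκ' ha hb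
          (fun s hs t ht => hIdist s hs.1 t ht.1) (fun s hs t ht => hIdist s hs.1 t ht.1)
          (fun s hs t ht => hIdist s hs.1 t ht.1) (a := a) (b := b) (fun s hs => hs.2)
          (fun s hs => hs.2) hl0.le
        have h1 : l * (2 * (a - b)) ≤ l * (2 * ε) := by nlinarith
        linarith [le_of_mul_le_mul_left h1 hl0]
    choose c hc using hloc
    refine ⟨fun t => c ⌊t / η⌋, ?_, ?_⟩
    · exact (measurable_from_top (f := c)).comp (Int.measurable_floor.comp (by fun_prop))
    · rw [ae_iff]
      refine measure_mono_null (t := ⋃ k : ℤ, {t | ⌊t / η⌋ = k} ∩ {t | 2 * ε < |(f t).im - c k|})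
        ?_ (measure_iUnion_null hc)
      intro t ht
      rw [Set.mem_iUnion]
      exact ⟨⌊t / η⌋, rfl, not_le.1 ht⟩
  choose h hhm hh using fun n : ℕ => hstep (1 / ((n : ℝ) + 1)) (by positivity)
  have him : AEMeasurable fun x => (f x).im := by
    refine aemeasurable_of_tendsto_metrizable_ae atTop (fun n => (hhm n).aemeasurable) ?_
    filter_upwards [ae_all_iff.2 hh] with t ht
    rw [tendsto_iff_dist_tendsto_zero]
    refine squeeze_zero (fun _ => dist_nonneg) (fun n => ?_)
      (g := fun n : ℕ => 2 * (1 / ((n : ℝ) + 1))) ?_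
    · rw [dist_comm, Real.dist_eq]; exact ht n
    · simpa using (tendsto_one_div_add_atTop_nhds_zero_nat (𝕜 := ℝ)).const_mul 2
  have : f = fun x => ((f x).re : ℂ) + (f x).im * Complex.I := by
    ext x; exact (Complex.re_add_im _).symm
  rw [this]
  exact (Complex.measurable_ofReal.comp_aemeasurable hm).add
    ((Complex.measurable_ofReal.comp_aemeasurable him).mul_const _)

end IsPositiveDefiniteFun

/-! ### Characters of the line. -/

/-- The kernel `χ (x - y) = χ x * conj (χ y)` has rank one, so its form is a squared modulus. -/
lemma isPositiveDefiniteFun_of_char {χ : ℝ → ℂ} (hadd : ∀ x y, χ (x + y) = χ x * χ y)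
    (hneg : ∀ x, χ (-x) = conj (χ x)) : IsPositiveDefiniteFun χ := by
  refine .of_quadForm hneg fun n x c => ?_
  have : ∑ i, ∑ j, conj (c i) * c j * χ (x i - x j)
      = conj (∑ i, c i * conj (χ (x i))) * ∑ j, c j * conj (χ (x j)) := by
    rw [map_sum, Finset.sum_mul_sum]
    refine Finset.sum_congr rfl fun i _ => Finset.sum_congr rfl fun j _ => ?_
    rw [sub_eq_add_neg, hadd, hneg, map_mul, Complex.conj_conj]
    ring
  rw [quadForm, this, Complex.conj_mul', ← Complex.ofReal_pow, Complex.ofReal_re]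
  positivity

lemma isPositiveDefiniteFun_exp_mul_I (t : ℝ) :
    IsPositiveDefiniteFun fun x => Complex.exp ((t * x : ℝ) * Complex.I) :=
  isPositiveDefiniteFun_of_char
    (fun x y => by rw [← Complex.exp_add]; congr 1; push_cast; ring)
    (fun x => by rw [← Complex.exp_conj]; congr 1; simp)

lemma isPositiveDefiniteFun_charFun (μ : Measure ℝ) [IsFiniteMeasure μ] :
    IsPositiveDefiniteFun (charFun μ) := by
  refine .of_quadForm (fun x => charFun_neg x) fun n x c => ?_
  have hint : ∀ t : ℝ, Integrable (fun ξ : ℝ => Complex.exp (ξ * t * Complex.I)) μ := by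
    intro t
    refine (integrable_const (1 : ℝ)).mono' (by fun_prop) (ae_of_all _ fun ξ => ?_)
    rw [← Complex.ofReal_mul, Complex.norm_exp_ofReal_mul_I]
  have h1 : ∑ i, ∑ j, conj (c i) * c j * charFun μ (x i - x j)
      = ∫ ξ : ℝ, ∑ i, ∑ j, conj (c i) * c j *
        Complex.exp (ξ * (x i - x j : ℝ) * Complex.I) ∂μ := by
    rw [integral_finsetSum _ fun i _ => integrable_finsetSum _ fun j _ => (hint _).const_mul _]
    refine Finset.sum_congr rfl fun i _ => ?_
    rw [integral_finsetSum _ fun j _ => (hint _).const_mul _]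
    refine Finset.sum_congr rfl fun j _ => ?_
    rw [integral_const_mul, charFun_apply_real]
    congr 2; ext ξ; congr 2; ring
  rw [quadForm, h1]
  have h2 : Integrable (fun ξ : ℝ => ∑ i, ∑ j, conj (c i) * c j *
      Complex.exp (ξ * (x i - x j : ℝ) * Complex.I)) μ :=
    integrable_finsetSum _ fun i _ => integrable_finsetSum _ fun j _ => (hint _).const_mul _
  rw [← RCLike.re_eq_complex_re, ← integral_re h2]
  refine integral_nonneg fun ξ => ?_
  have := (isPositiveDefiniteFun_exp_mul_I ξ).quadForm_nonneg x c
  simpa [quadForm] using this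

/-- A continuous unitary character of the real line is an exponential. -/
lemma exists_char_eq_exp {χ : ℝ → ℂ} (hc : Continuous χ) (hadd : ∀ x y, χ (x + y) = χ x * χ y)
    (hnorm : ∀ x, ‖χ x‖ = 1) : ∃ t : ℝ, ∀ x, χ x = Complex.exp ((t * x : ℝ) * Complex.I) := by
  have hne : ∀ x, χ x ≠ 0 := fun x h => by simpa [h] using hnorm x
  have h0 : χ 0 = 1 := by
    have := hadd 0 0
    rw [add_zero] at this
    exact (mul_eq_left₀ (hne 0)).1 this.symm
  set P : ℝ → ℂ := fun x => ∫ u in (0 : ℝ)..x, χ u with hP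
  have hPd : ∀ x, HasDerivAt P (χ x) x := fun x => (hc.integral_hasStrictDerivAt 0 x).hasDerivAt
  obtain ⟨δ, hδ⟩ : ∃ δ, P δ ≠ 0 := by
    by_contra! hz
    have h1 : P = fun _ => 0 := funext hz
    have h2 := hPd 0
    rw [h1, h0] at h2
    exact zero_ne_one ((hasDerivAt_const (0 : ℝ) (0 : ℂ)).unique h2)
  -- Integrating `χ (x + u) = χ x * χ u` over `[0, δ]` expresses `χ` through its primitive, hence
  -- makes it differentiable.
  have hχ : χ = fun x => (P (x + δ) - P x) / P δ := by
    ext x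
    rw [eq_div_iff hδ, hP]
    simp only
    rw [intervalIntegral.integral_interval_sub_left (hc.intervalIntegrable _ _)
      (hc.intervalIntegrable _ _), ← intervalIntegral.integral_const_mul]
    simp_rw [← hadd]
    rw [intervalIntegral.integral_comp_add_left (fun u => χ u) x, add_zero]
  obtain ⟨c, hc0⟩ : ∃ c, HasDerivAt χ c 0 := by
    refine ⟨(χ (0 + δ) - χ 0) / P δ, ?_⟩
    have h1 := (((hPd (0 + δ)).comp_add_const 0 δ).sub (hPd 0)).div_const (P δ)
    rw [hχ]
    rw [hχ] at h1
    exact h1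
  have hcd : ∀ x, HasDerivAt χ (χ x * c) x := by
    intro x
    have h1 : HasDerivAt (fun y => χ x * χ (y - x)) (χ x * c) x := by
      have h2 : HasDerivAt χ c (x - x) := by simpa using hc0
      exact (h2.comp_sub_const x x).const_mul _
    convert! h1 using 1
    ext y
    rw [← hadd, add_sub_cancel]
  have hexp : ∀ x : ℝ, χ x = Complex.exp (c * x) := by
    have hd : ∀ x : ℝ, HasDerivAt (fun x : ℝ => χ x * Complex.exp (-(c * x))) 0 x := by
      intro x
      have h1 : HasDerivAt (fun x : ℝ => Complex.exp (-(c * x)))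
          (Complex.exp (-(c * x)) * -c) x := by
        have := ((Complex.ofRealCLM.hasDerivAt (x := x)).const_mul c).neg.cexp
        simpa using this
      convert! (hcd x).mul h1 using 1
      ring
    intro x
    have h2 := is_const_of_deriv_eq_zero (fun x => (hd x).differentiableAt)
      (fun x => (hd x).deriv) x 0
    simp only [h0, Complex.ofReal_zero, mul_zero, neg_zero, Complex.exp_zero, mul_one] at h2
    rw [Complex.exp_neg, ← div_eq_mul_inv, div_eq_one_iff_eq (Complex.exp_ne_zero _)] at h2
    exact h2
  have hre : c.re = 0 := by
    have h1 := hnorm 1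
    rw [hexp, Complex.norm_exp] at h1
    simpa using h1
  refine ⟨c.im, fun x => ?_⟩
  rw [hexp]
  congr 1
  rw [← Complex.re_add_im c, hre]
  push_cast
  simp
  ring

/-- A measurable unitary character of the real line is an exponential. -/
lemma exists_char_eq_exp_of_aemeasurable {χ : ℝ → ℂ} (hm : AEMeasurable χ)
    (hadd : ∀ x y, χ (x + y) = χ x * χ y) (hnorm : ∀ x, ‖χ x‖ = 1) :
    ∃ t : ℝ, ∀ x, χ x = Complex.exp ((t * x : ℝ) * Complex.I) := by
  have hne : ∀ x, χ x ≠ 0 := fun x h => by simpa [h] using hnorm x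
  have h0 : χ 0 = 1 := by
    have := hadd 0 0
    rw [add_zero] at this
    exact (mul_eq_left₀ (hne 0)).1 this.symm
  have hneg : ∀ x, χ (-x) = conj (χ x) := by
    intro x
    have h1 : χ (-x) * χ x = 1 := by rw [← hadd, neg_add_cancel, h0]
    have h2 : conj (χ x) * χ x = 1 := by rw [Complex.conj_mul', hnorm]; simp
    exact mul_right_cancel₀ (hne x) (h1.trans h2.symm)
  obtain ⟨ν, _, hν⟩ := (isPositiveDefiniteFun_of_char hadd hneg).exists_ae_eq_charFun hm
  refine exists_char_eq_exp ?_ hadd hnorm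
  have hcf : Continuous (charFun ν) := continuous_charFun
  have hχ : χ = fun x => charFun ν x * charFun ν 0 := by
    ext x
    -- `χ x = χ (x - y) * χ y` for all `y`; the a.e. replacement is continuous in `y`, so it also
    -- holds at `y = 0`.
    have h1 : ∀ᵐ y, (fun _ => χ x) y = charFun ν (x - y) * charFun ν y := by
      filter_upwards [hν, (quasiMeasurePreserving_sub_left volume x).ae hν] with y hy hy'
      rw [← hy, ← hy', ← hadd, sub_add_cancel]
    have h2 := congrFun ((Continuous.ae_eq_iff_eq volume continuous_const
      ((hcf.comp (by fun_prop)).mul hcf)).1 h1) 0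
    simpa using h2
  rw [hχ]
  exact hcf.mul continuous_const

/-! ### Bounded holomorphic extensions to half planes. -/

section HalfPlane

variable {U : Set ℂ} {F : ℂ → ℂ} {Φ : ℝ → ℂ}

/-- The Fourier–Laplace transform of a finite measure on the half line `[0, ∞)`. -/
lemma isBoundedHolomorphicExtension_charFun {ν : Measure ℝ} [IsFiniteMeasure ν]
    (hν : ∀ᵐ ξ ∂ν, 0 ≤ ξ) :
    ∃ E : ℂ → ℂ, IsBoundedHolomorphicExtension upperHalf E (charFun ν) ∧
      ∀ x : ℝ, E x = charFun ν x := by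
  set E : ℂ → ℂ := fun z => ∫ ξ : ℝ, Complex.exp (Complex.I * z * ξ) ∂ν with hE
  have hEx : ∀ x : ℝ, E x = charFun ν x := fun x => by
    rw [hE, charFun_apply_real]
    simp only
    congr 1; ext ξ; congr 1; ring
  have hcl : closure upperHalf ⊆ {z : ℂ | 0 ≤ z.im} :=
    (Complex.closure_setOfPred_lt_im 0).subset
  have hnorm : ∀ z : ℂ, 0 ≤ z.im → ∀ᵐ ξ : ℝ ∂ν, ‖Complex.exp (Complex.I * z * ξ)‖ ≤ 1 := by
    intro z hz
    filter_upwards [hν] with ξ hξ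
    rw [Complex.norm_exp, Real.exp_le_one_iff]
    simp
    positivity
  refine ⟨E, ⟨?_, ?_, ?_, ae_of_all _ hEx⟩, hEx⟩
  -- `E z` is the complex moment generating function at `I * z`, whose real part is `-Im z`.
  · have hset : Set.Iic 0 ⊆ ProbabilityTheory.integrableExpSet id ν := by
      intro s hs
      have hs' : s ≤ 0 := hs
      refine (integrable_const (1 : ℝ)).mono' (by fun_prop) ?_
      filter_upwards [hν] with ξ hξ
      rw [Real.norm_of_nonneg (Real.exp_pos _).le, Real.exp_le_one_iff]
      exact mul_nonpos_of_nonpos_of_nonneg hs' hξ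
    have hint : Set.Iio 0 ⊆ interior (ProbabilityTheory.integrableExpSet id ν) :=
      interior_maximal (Set.Iio_subset_Iic_self.trans hset) isOpen_Iio
    have h1 := (ProbabilityTheory.differentiableOn_complexMGF (X := id) (μ := ν)).comp
      (f := fun z => Complex.I * z) (s := upperHalf) (by fun_prop) (fun z hz => hint (by
        have hz' : 0 < z.im := hz
        simpa using hz'))
    exact h1
  · refine ContinuousOn.mono ?_ hcl
    refine continuousOn_of_dominated (bound := fun _ => 1) (fun z _ => by fun_prop) (fun z hz => ?_)
      (integrable_const _) (ae_of_all _ fun ξ => by fun_prop)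
    exact hnorm z hz
  · refine ⟨ν.real Set.univ, fun z hz => ?_⟩
    have hz' : 0 < z.im := hz
    refine (norm_integral_le_of_norm_le (integrable_const (1 : ℝ)) (hnorm z hz'.le)).trans ?_
    simp

lemma isBoundedHolomorphicExtension_exp {t : ℝ} (ht : 0 ≤ t) :
    IsBoundedHolomorphicExtension upperHalf (fun z => Complex.exp (t * z * Complex.I))
      fun x => Complex.exp ((t * x : ℝ) * Complex.I) where
  holomorphic := by fun_prop
  continuous_closure := by fun_prop
  bounded := ⟨1, fun z hz => by
    have hz' : 0 < z.im := hz
    rw [Complex.norm_exp, Real.exp_le_one_iff]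
    simp
    positivity⟩
  boundary := ae_of_all _ fun x => by push_cast; rfl

lemma IsBoundedHolomorphicExtension.mul {F' : ℂ → ℂ} {Φ' : ℝ → ℂ}
    (h : IsBoundedHolomorphicExtension U F Φ) (h' : IsBoundedHolomorphicExtension U F' Φ') :
    IsBoundedHolomorphicExtension U (fun z => F z * F' z) fun x => Φ x * Φ' x where
  holomorphic := h.holomorphic.mul h'.holomorphic
  continuous_closure := h.continuous_closure.mul h'.continuous_closure
  bounded := by
    obtain ⟨C, hC⟩ := h.bounded
    obtain ⟨C', hC'⟩ := h'.bounded
    refine ⟨C * C', fun z hz => ?_⟩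
    rw [norm_mul]
    exact mul_le_mul (hC z hz) (hC' z hz) (norm_nonneg _) ((norm_nonneg _).trans (hC z hz))
  boundary := by
    filter_upwards [h.boundary, h'.boundary] with x hx hx'
    rw [hx, hx']

lemma IsBoundedHolomorphicExtension.cexp (h : IsBoundedHolomorphicExtension U F Φ) :
    IsBoundedHolomorphicExtension U (fun z => Complex.exp (F z)) fun x => Complex.exp (Φ x) where
  holomorphic := h.holomorphic.cexp
  continuous_closure := h.continuous_closure.cexp
  bounded := by
    obtain ⟨C, hC⟩ := h.bounded
    refine ⟨Real.exp C, fun z hz => ?_⟩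
    rw [Complex.norm_exp]
    exact Real.exp_le_exp.2 ((Complex.re_le_norm _).trans (hC z hz))
  boundary := by
    filter_upwards [h.boundary] with x hx
    rw [hx]

lemma isBoundedHolomorphicExtension_const (c : ℂ) :
    IsBoundedHolomorphicExtension U (fun _ => c) fun _ => c where
  holomorphic := by fun_prop
  continuous_closure := by fun_prop
  bounded := ⟨‖c‖, fun _ _ => le_rfl⟩
  boundary := ae_of_all _ fun _ => rfl

lemma IsBoundedHolomorphicExtension.congr_ae {Φ' : ℝ → ℂ}
    (h : IsBoundedHolomorphicExtension U F Φ) (hΦ : ∀ᵐ x, Φ x = Φ' x) :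
    IsBoundedHolomorphicExtension U F Φ' where
  __ := h
  boundary := by
    filter_upwards [h.boundary, hΦ] with x hx hx'
    rw [hx, hx']

lemma IsBoundedHolomorphicExtension.comp_neg
    (h : IsBoundedHolomorphicExtension upperHalf F Φ) :
    IsBoundedHolomorphicExtension lowerHalf (fun z => F (-z)) fun x => Φ (-x) where
  holomorphic := h.holomorphic.comp (by fun_prop) fun z hz => by
    have hz' : z.im < 0 := hz
    change 0 < (-z).im
    simpa using hz'
  continuous_closure := by
    refine h.continuous_closure.comp (by fun_prop) ?_
    have hm : Set.MapsTo (fun z : ℂ => -z) lowerHalf upperHalf := fun z hz => by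
      have hz' : z.im < 0 := hz
      change 0 < (-z).im
      simpa using hz'
    exact hm.closure continuous_neg
  bounded := by
    obtain ⟨C, hC⟩ := h.bounded
    refine ⟨C, fun z hz => hC _ ?_⟩
    have hz' : z.im < 0 := hz
    change 0 < (-z).im
    simpa using hz'
  boundary := by
    filter_upwards [(Measure.measurePreserving_neg volume).quasiMeasurePreserving.ae h.boundary]
      with x hx
    simpa using hx

/-- The factor `exp (i t x) * exp (charFun ν x)` extends to the upper half plane if `t` and the
support of `ν` are nonnegative. -/
lemma exists_extension_upperHalf {ν : Measure ℝ} [IsFiniteMeasure ν] (hν : ∀ᵐ ξ ∂ν, 0 ≤ ξ)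
    {t : ℝ} (ht : 0 ≤ t) : ∃ F : ℂ → ℂ, IsBoundedHolomorphicExtension upperHalf F
      (fun x => Complex.exp ((t * x : ℝ) * Complex.I) * Complex.exp (charFun ν x)) ∧
      ∀ x : ℝ, F x = Complex.exp ((t * x : ℝ) * Complex.I) * Complex.exp (charFun ν x) := by
  obtain ⟨E, hE, hEx⟩ := isBoundedHolomorphicExtension_charFun hν
  refine ⟨_, (isBoundedHolomorphicExtension_exp ht).mul hE.cexp, fun x => ?_⟩
  rw [hEx]
  push_cast
  rfl

/-- Reflecting `ν` and `t` reduces this to the upper half plane. -/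
lemma exists_extension_lowerHalf {ν : Measure ℝ} [IsFiniteMeasure ν] (hν : ∀ᵐ ξ ∂ν, ξ ≤ 0)
    {t : ℝ} (ht : t ≤ 0) : ∃ F : ℂ → ℂ, IsBoundedHolomorphicExtension lowerHalf F
      (fun x => Complex.exp ((t * x : ℝ) * Complex.I) * Complex.exp (charFun ν x)) ∧
      ∀ x : ℝ, F x = Complex.exp ((t * x : ℝ) * Complex.I) * Complex.exp (charFun ν x) := by
  set ν' : Measure ℝ := ν.map fun x => (-1) * x with hν'
  have h1 : ∀ᵐ ξ ∂ν', 0 ≤ ξ := by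
    rw [hν', ae_map_iff (by fun_prop) measurableSet_Ici]
    filter_upwards [hν] with ξ hξ
    linarith
  obtain ⟨F, hF, hFx⟩ := exists_extension_upperHalf h1 (neg_nonneg.2 ht)
  have h2 : ∀ x : ℝ, charFun ν' (-x) = charFun ν x := fun x => by
    rw [hν', charFun_map_mul]; congr 1; ring
  have h3 := hF.comp_neg
  simp only [h2, neg_mul_neg] at h3
  refine ⟨_, h3, fun x => ?_⟩
  have := hFx (-x)
  rw [h2, neg_mul_neg] at this
  rw [← this]
  push_cast
  rfl

end HalfPlane

/-! ### The factorization. -/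

theorem mainTheorem2 (f : ℝ → ℂ)
    (hL2 : ∃ c : ℂ, MemLp (fun x => f x - c) 2 (volume : Measure ℝ))
    (hbdd : ∃ b : ℝ, ∀ x, ‖f x‖ ≤ b)
    (haway : ∃ a : ℝ, 0 < a ∧ ∀ x, a ≤ ‖f x‖)
    -- `g` is the choice of the logarithm of `f` that defines the powers `f ^ s = exp (s * g)`
    (g : ℝ → ℂ) (hg : ∀ x, Complex.exp (g x) = f x)
    (hpow : ∀ s : ℝ, 0 < s → IsPositiveDefiniteFun (fun x => Complex.exp ((s : ℂ) * g x))) :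
    ∃ (Φp Φm : ℝ → ℂ) (Fp Fm : ℂ → ℂ),
      (∀ x, f x = Φp x * Φm x) ∧
      IsPositiveDefiniteFun Φp ∧
      IsPositiveDefiniteFun Φm ∧
      IsBoundedHolomorphicExtension upperHalf Fp Φp ∧
      IsBoundedHolomorphicExtension lowerHalf Fm Φm ∧
      (Continuous f → (∀ x : ℝ, Fp (x : ℂ) = Φp x) ∧ (∀ x : ℝ, Fm (x : ℂ) = Φm x)) := by
  obtain ⟨a, ha0, ha⟩ := haway
  obtain ⟨b, hb⟩ := hbdd
  have hnormf : ∀ x, ‖f x‖ = Real.exp (g x).re := fun x => by rw [← hg, Complex.norm_exp]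
  have hre : ∀ x, (g x).re = Real.log ‖f x‖ := fun x => by rw [hnormf, Real.log_exp]
  have hB : ∀ x, |(g x).re| ≤ max |Real.log a| |Real.log b| := fun x => by
    rw [hre]
    exact abs_le_max_abs_abs (Real.log_le_log ha0 (ha x))
      (Real.log_le_log (ha0.trans_le (ha x)) (hb x))
  obtain ⟨α, K, hφ⟩ :=
    (IsConditionallyPositiveDefiniteFun.of_exp hpow).exists_isPositiveDefiniteFun hB
  set φ : ℝ → ℂ := fun x => g x - (α x : ℂ) * Complex.I + K with hφdef
  have hfm : AEMeasurable f := by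
    obtain ⟨c, hc⟩ := hL2
    simpa using hc.aestronglyMeasurable.aemeasurable.add_const c
  have hφm : AEMeasurable φ := by
    refine hφ.aemeasurable_of_re ?_
    have : (fun x => (φ x).re) = fun x => Real.log ‖f x‖ + K := by
      ext x; simp [hφdef, hre]
    rw [this]
    exact (Real.measurable_log.comp_aemeasurable hfm.norm).add_const K
  have hfφ : ∀ x, f x = Complex.exp (-K : ℝ) * Complex.exp (α x * Complex.I)
      * Complex.exp (φ x) := fun x => by
    rw [← hg, ← Complex.exp_add, ← Complex.exp_add, hφdef]
    congr 1
    push_cast; ring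
  obtain ⟨t, ht⟩ := exists_char_eq_exp_of_aemeasurable
    (χ := fun x => Complex.exp (α x * Complex.I)) (by
      -- The character inherits measurability from `f` and `φ`, since `e^{iα} = e^K f e^{-φ}`.
      have : (fun x => Complex.exp (α x * Complex.I))
          = fun x => Complex.exp (K : ℝ) * f x * Complex.exp (-φ x) := by
        ext x
        rw [← hg, ← Complex.exp_add, ← Complex.exp_add, hφdef]
        congr 1
        ring
      rw [this]
      exact (hfm.const_mul _).mul (Complex.measurable_exp.comp_aemeasurable hφm.neg))
    (fun x y => by rw [← Complex.exp_add, map_add]; congr 1; push_cast; ring)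
    (fun x => Complex.norm_exp_ofReal_mul_I _)
  obtain ⟨μ, _, hμ⟩ := hφ.exists_ae_eq_charFun hφm
  have hψ := hφ.sub_of_ae_eq continuous_charFun (fun x => charFun_neg x) hμ
  set ψ : ℝ → ℂ := fun x => φ x - charFun μ x with hψdef
  have hψ0 : ∀ᵐ x, ψ x = 0 := by
    filter_upwards [hμ] with x hx
    rw [hψdef]; simp only [hx, sub_self]
  set μp := μ.restrict (Set.Ici 0) with hμp
  set μm := μ.restrict (Set.Iio 0) with hμm
  have hsum : ∀ x, charFun μ x = charFun μp x + charFun μm x := fun x => by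
    have hint : Integrable (fun ξ : ℝ => Complex.exp (x * ξ * Complex.I)) μ := by
      refine (integrable_const (1 : ℝ)).mono' (by fun_prop) (ae_of_all _ fun ξ => ?_)
      rw [← Complex.ofReal_mul, Complex.norm_exp_ofReal_mul_I]
    rw [charFun_apply_real, charFun_apply_real, charFun_apply_real, hμp, hμm, ← Set.compl_Ici,
      integral_add_compl measurableSet_Ici hint]
  have hp : ∀ᵐ ξ ∂μp, 0 ≤ ξ := ae_restrict_mem measurableSet_Ici
  have hm : ∀ᵐ ξ ∂μm, ξ ≤ 0 := (ae_restrict_mem measurableSet_Iio).mono fun ξ hξ => le_of_lt hξ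
  obtain ⟨Fp, hFp, hFpx⟩ := exists_extension_upperHalf hp (le_max_right t 0)
  obtain ⟨Fm, hFm, hFmx⟩ := exists_extension_lowerHalf hm (min_le_right t 0)
  have hfact : ∀ x, f x = Complex.exp (-K : ℝ) * (Complex.exp ((max t 0 * x : ℝ) * Complex.I)
      * Complex.exp (charFun μp x)) * Complex.exp (ψ x)
      * (Complex.exp ((min t 0 * x : ℝ) * Complex.I) * Complex.exp (charFun μm x)) := fun x => by
    have htt : ((t * x : ℝ) : ℂ) = (max t 0 * x : ℝ) + (min t 0 * x : ℝ) := by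
      rw [← Complex.ofReal_add, ← add_mul, max_add_min, add_zero]
    have hφx : φ x = charFun μp x + charFun μm x + ψ x := by
      rw [hψdef, ← hsum]; simp
    rw [hfφ, ht, htt, hφx, add_mul, Complex.exp_add, Complex.exp_add, Complex.exp_add]
    ring
  refine ⟨fun x => Complex.exp (-K : ℝ) * (Complex.exp ((max t 0 * x : ℝ) * Complex.I)
      * Complex.exp (charFun μp x)) * Complex.exp (ψ x),
    fun x => Complex.exp ((min t 0 * x : ℝ) * Complex.I) * Complex.exp (charFun μm x),
    fun z => Complex.exp (-K : ℝ) * Fp z, Fm, hfact, ?_, ?_, ?_, hFm, fun hcont => ?_⟩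
  · simp only [← Complex.ofReal_exp]
    exact ((((isPositiveDefiniteFun_exp_mul_I _).mul (isPositiveDefiniteFun_charFun μp).exp)
      |>.ofReal_mul (Real.exp_pos _).le).mul hψ.exp)
  · exact (isPositiveDefiniteFun_exp_mul_I _).mul (isPositiveDefiniteFun_charFun μm).exp
  · refine ((isBoundedHolomorphicExtension_const _).mul hFp).congr_ae ?_
    filter_upwards [hψ0] with x hx
    rw [hx, Complex.exp_zero, mul_one]
  -- Two continuous functions equal a.e. agree at `0`, so `e^{ψ(0)} = 1` and `Re ψ(0) = 0`, which
  -- bounds `‖ψ x‖` for every `x`.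
  · have hψz : ∀ x, ψ x = 0 := by
      have hcp : Continuous (charFun μp) := continuous_charFun
      have hcm : Continuous (charFun μm) := continuous_charFun
      have h1 : f = fun x : ℝ =>
          Complex.exp (-K : ℝ) * (Complex.exp ((max t 0 * x : ℝ) * Complex.I)
          * Complex.exp (charFun μp x))
          * (Complex.exp ((min t 0 * x : ℝ) * Complex.I) * Complex.exp (charFun μm x)) := by
        refine (Continuous.ae_eq_iff_eq volume hcont (by fun_prop)).1 ?_
        filter_upwards [hψ0] with x hx
        rw [hfact x, hx, Complex.exp_zero, mul_one]
      have h2 : Complex.exp (ψ 0) = 1 := by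
        have h3 := (hfact 0).symm.trans (congrFun h1 0)
        simp only [mul_zero, Complex.ofReal_zero, zero_mul, Complex.exp_zero, one_mul] at h3
        have h4 := mul_right_cancel₀ (Complex.exp_ne_zero _) h3
        exact (mul_eq_left₀ (mul_ne_zero (Complex.exp_ne_zero _) (Complex.exp_ne_zero _))).1 h4
      have h5 : (ψ 0).re = 0 := by
        have h6 := congrArg norm h2
        rw [Complex.norm_exp, norm_one] at h6
        exact Real.exp_eq_one_iff _ |>.1 h6
      intro x
      have h7 := hψ.norm_le x
      rw [h5] at h7
      exact norm_le_zero_iff.1 h7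
    refine ⟨fun x => ?_, hFmx⟩
    simp only [hFpx, hψz, Complex.exp_zero, mul_one]
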